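/- **Theorem.** Let $n\ge 3$ be an integer and $r>0$, and let $\mathcal P_{n,r}\subset\mathbb R^2$ be the (filled) regular polygon with $n$ sides, circumradius $r$ and centre at the origin $O$ (in any orientation); let $u$ be its perimeter. For $p\ge 0$ and $0\le\phi<2\pi$ let $g(p,\phi)=\{(x,y): x\cos\phi+y\sin\phi=p\}$, and let $\mu$ be the motion invariant line measure $\mathrm dg=\mathrm dp\,\mathrm d\phi$. For a line $g$ let $|\chi(g)|$ be the length of the chord $\chi(g)=g\cap\mathcal P_{n,r}$, and let $$F(s)=\frac1u\,\mu\big(\{g:\ g\cap\mathcal P_{n,r}\ne\emptyset,\ |\chi(g)|\le s\}\big),\qquad s\in\mathbb R,$$ be the chord length distribution function of $\mathcal P_{n,r}$. Put $$\ell_k=2r\sin\frac{k\pi}{n},\qquad K=\Big\lfloor\frac{n-2}{2}\Big\rfloor,\qquad \lambda=2r\cos^2\frac{\pi}{2n}.$$ Then $$F(s)=\begin{cases}0 & \text{if } s<\ell_0=0,\\ H_k(s) & \text{if } \ell_k\le s<\ell_{k+1},\ k=0,\dots,K,\\ 1 & \text{if } s\ge\ell_{K+1},\end{cases}$$ where $$H_k(s)=\begin{cases}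 1-h_k(s,A_1(k),B_1(k))+h_{k+1}\big(s,A_1(k),B_1(k)+\tfrac{\pi}{n}\big) & \text{if ($n$ is even and $k\in\{0,\dots,K-1\}$) or ($n$ is odd and $s<\lambda$)},\\[2mm] 1-h_K(s,A_1(K),B_1(K))+h_{K+1}\big(s,A_1(K),B_1(K)+\tfrac{\pi}{n}\big)\\ \quad-\,h_{K+1}\big(s,A_2,B_2+\tfrac{\pi}{n}\big)-h_{K+1}(s,A_2,B_2) & \text{if $n$ is odd and $s\ge\lambda$},\\[2mm] 1-h_K(s,A_1(K),B_1(K)) & \text{if $n$ is even and $k=K$}, \end{cases}$$ with $$A_1(k)=2r\sin\frac{k\pi}{n}\sin\frac{(k+1)\pi}{n},\quad B_1(k)=\frac{k\pi}{n},\quad A_2=2r\cos^2\frac{\pi}{2n},\quad B_2=\frac{\pi}{2}\Big(1-\frac1n\Big),$$ $h_0(s,a,b)=0$ and, for $k\ge1$, $$h_k(s,a,b)=\Theta_1(k,a,b)\,s+\Theta_2(k,a,b)\,\frac1s+\Theta_3(k,a,b)\,\frac{\sqrt{s^2-a^2}}{s}+\Theta_4(k,a,b)\,s\arcsin\frac as,$$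 where $$\begin{aligned} \Theta_1(k,a,b)&=\frac1{4r}\csc\frac{\pi}{n}\Big(\sin(2b)\csc\frac{2k\pi}{n}-2b\cot\frac{2k\pi}{n}\Big),\\ \Theta_2(k,a,b)&=a\Big(\cos b\,\cot\frac{\pi}{n}\sec\frac{k\pi}{n}-\frac{a}{2r}\sin(2b)\csc\frac{\pi}{n}\csc\frac{2k\pi}{n}\Big),\\ \Theta_3(k,a,b)&=-\Big(\sin b\,\cot\frac{\pi}{n}\sec\frac{k\pi}{n}+\frac{a}{2r}\cos(2b)\csc\frac{\pi}{n}\csc\frac{2k\pi}{n}\Big),\\ \Theta_4(k,a,b)&=\frac1{2r}\csc\frac{\pi}{n}\cot\frac{2k\pi}{n}. \end{aligned}$$ At $s=0$, where the terms of $H_0$ containing $1/s$ are undefined, $H_0(0)$ is understood as $\lim_{s\downarrow0}H_0(s)$; that is, this limit exists and equals $F(0)=0$. -/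

import Mathlib

open MeasureTheory

noncomputable section

namespace ChordLength

/-- The Euclidean plane. -/
abbrev Plane : Type := EuclideanSpace ℝ (Fin 2)

/-! ### Lines and the motion invariant line measure -/

/-- The line `g(p, φ) = {(x, y) | x cos φ + y sin φ = p}`. -/
def line (p φ : ℝ) : Set Plane :=
  {x | x 0 * Real.cos φ + x 1 * Real.sin φ = p}

/-- The motion invariant measure `∫ dp dφ` of a set `M` of lines, the lines being parametrized
by their distance `0 ≤ p < ∞` from the origin and their normal angle `0 ≤ φ < 2π`. -/
def lineMeasure (M : Set (Set Plane)) : ENNReal :=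
  volume {q : ℝ × ℝ | 0 ≤ q.1 ∧ 0 ≤ q.2 ∧ q.2 < 2 * Real.pi ∧ line q.1 q.2 ∈ M}

/-! ### The regular polygon -/

/-- The vertices of the regular `n`-gon with circumradius `r` and centre at the origin;
`θ` is the polar angle of the vertex with index `0`. -/
def vertex (n : ℕ) (r θ : ℝ) (i : ℕ) : Plane :=
  !₂[r * Real.cos (θ + 2 * Real.pi * i / n), r * Real.sin (θ + 2 * Real.pi * i / n)]

/-- The (filled) regular `n`-gon. -/
def polygon (n : ℕ) (r θ : ℝ) : Set Plane :=
  convexHull ℝ (Set.range fun i : Fin n => vertex n r θ i)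

/-- The perimeter of the regular `n`-gon: the sum of its side lengths. -/
def perimeter (n : ℕ) (r θ : ℝ) : ℝ :=
  ∑ i ∈ Finset.range n, dist (vertex n r θ i) (vertex n r θ (i + 1))

/-- The length of the chord that the set `g` cuts out of the polygon
(one-dimensional Hausdorff measure, i.e. the usual length of a segment). -/
def chordLength (n : ℕ) (r θ : ℝ) (g : Set Plane) : ℝ :=
  (Measure.hausdorffMeasure 1 : Measure Plane).real (g ∩ polygon n r θ)

/-- The chord length distribution function of the regular `n`-gon. -/
def F (n : ℕ) (r θ s : ℝ) : ℝ :=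
  1 / perimeter n r θ *
    (lineMeasure {g | (g ∩ polygon n r θ).Nonempty ∧ chordLength n r θ g ≤ s}).toReal

/-! ### The closed form -/

def csc (x : ℝ) : ℝ := 1 / Real.sin x

def sec (x : ℝ) : ℝ := 1 / Real.cos x

def cot (x : ℝ) : ℝ := Real.cos x / Real.sin x

/-- `ℓ_k = 2 r sin (k π / n)`. -/
def ell (n : ℕ) (r : ℝ) (k : ℕ) : ℝ := 2 * r * Real.sin (k * Real.pi / n)

/-- `K = ⌊(n - 2) / 2⌋` (used for `n ≥ 3`). -/
def K (n : ℕ) : ℕ := (n - 2) / 2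

/-- `λ = 2 r cos² (π / (2 n))`. -/
def lam (n : ℕ) (r : ℝ) : ℝ := 2 * r * Real.cos (Real.pi / (2 * n)) ^ 2

def A₁ (n : ℕ) (r : ℝ) (k : ℕ) : ℝ :=
  2 * r * Real.sin (k * Real.pi / n) * Real.sin ((k + 1) * Real.pi / n)

def B₁ (n : ℕ) (k : ℕ) : ℝ := k * Real.pi / n

def A₂ (n : ℕ) (r : ℝ) : ℝ := 2 * r * Real.cos (Real.pi / (2 * n)) ^ 2

def B₂ (n : ℕ) : ℝ := Real.pi / 2 * (1 - 1 / n)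

def Θ₁ (n : ℕ) (r : ℝ) (k : ℕ) (_a b : ℝ) : ℝ :=
  1 / (4 * r) * csc (Real.pi / n) *
    (Real.sin (2 * b) * csc (2 * k * Real.pi / n) - 2 * b * cot (2 * k * Real.pi / n))

def Θ₂ (n : ℕ) (r : ℝ) (k : ℕ) (a b : ℝ) : ℝ :=
  a * (Real.cos b * cot (Real.pi / n) * sec (k * Real.pi / n)
    - a / (2 * r) * Real.sin (2 * b) * csc (Real.pi / n) * csc (2 * k * Real.pi / n))

def Θ₃ (n : ℕ) (r : ℝ) (k : ℕ) (a b : ℝ) : ℝ :=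
  -(Real.sin b * cot (Real.pi / n) * sec (k * Real.pi / n)
    + a / (2 * r) * Real.cos (2 * b) * csc (Real.pi / n) * csc (2 * k * Real.pi / n))

def Θ₄ (n : ℕ) (r : ℝ) (k : ℕ) (_a _b : ℝ) : ℝ :=
  1 / (2 * r) * csc (Real.pi / n) * cot (2 * k * Real.pi / n)

def L₁ (s _a : ℝ) : ℝ := s

def L₂ (s _a : ℝ) : ℝ := 1 / s

def L₃ (s a : ℝ) : ℝ := Real.sqrt (s ^ 2 - a ^ 2) / s

def L₄ (s a : ℝ) : ℝ := s * Real.arcsin (a / s)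

/-- The functions `h_k(s, a, b)`. -/
def h (n : ℕ) (r : ℝ) (k : ℕ) (s a b : ℝ) : ℝ :=
  if k = 0 then 0
  else Θ₁ n r k a b * L₁ s a + Θ₂ n r k a b * L₂ s a
    + Θ₃ n r k a b * L₃ s a + Θ₄ n r k a b * L₄ s a

open Classical in
/-- The functions `H_k(s)`. They are only used for `0 ≤ k ≤ K`, so that the last branch is the
case in which `n` is even and `k = K`. -/
def H (n : ℕ) (r : ℝ) (k : ℕ) (s : ℝ) : ℝ :=
  if (Even n ∧ k < K n) ∨ (Odd n ∧ s < lam n r) then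
    1 - h n r k s (A₁ n r k) (B₁ n k)
      + h n r (k + 1) s (A₁ n r k) (B₁ n k + Real.pi / n)
  else if Odd n ∧ lam n r ≤ s then
    1 - h n r (K n) s (A₁ n r (K n)) (B₁ n (K n))
      + h n r (K n + 1) s (A₁ n r (K n)) (B₁ n (K n) + Real.pi / n)
      - h n r (K n + 1) s (A₂ n r) (B₂ n + Real.pi / n)
      - h n r (K n + 1) s (A₂ n r) (B₂ n)
  else
    1 - h n r (K n) s (A₁ n r (K n)) (B₁ n (K n))

end ChordLength

end

noncomputable section

namespace ChordLength

/-! ### Coordinates adapted to a line -/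

/-! `F` is one minus the normalized measure of the lines whose chord is longer than `s`: the lines
that meet the polygon have total measure equal to the perimeter (Crofton), which is checked by
integrating the support function `r cos ψ` of the nearest vertex.

Fix a normal direction φ. By convexity, the positions p at which the chord is longer than `s` form
an interval, with endpoints -e(φ+π) and e(φ), where e(φ) is the largest p carrying a chord of length
at least `s` (`volume_longChord`). Pairing φ with φ+π removes the restriction p ≥ 0, so the required
measure is the integral of e over a full turn. By the dihedral symmetry this is 2n times an integral
over [0, π/n] (`longMeasure_eq`).

The extremal chord joins two sides. If their normals enclose the angle 2β, with β = κπ/n,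
eliminating the chord parameter from the two side inequalities bounds p by `chordDist`, and the
bound is attained when the endpoints lie on the sides themselves (`isUpper_chordDist`). For ℓ_k ≤ s
< ℓ_{k+1} the index gap κ is k near an axis of symmetry and k+1 beyond the angle m = arcsin(A₁(k)/s)
- kπ/n, at which the chord passes through a vertex. Two cases deviate: for even n and k = K the
sides k+1 apart are parallel, and beyond m no chord of length s exists; for odd n and s ≥ λ, the
width orthogonal to a side, a further range of directions has no such chord. There e is replaced by
0.

The formula follows because `chordDist` has an elementary primitive, and h_k(s,a,b) is this
primitive at arcsin(a/s) - b, divided by r sin(π/n) (`h_eq_chordDistPrim`). The value at s = 0 comes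
from monotonicity of `F` and the limit of `H` at 0. -/

/-- The point with signed distance `t` from the foot of the normal on the line `g(p, φ)`. -/
def pt (p φ t : ℝ) : Plane :=
  !₂[p * Real.cos φ - t * Real.sin φ, p * Real.sin φ + t * Real.cos φ]

/-- The coordinate of `x` in the direction with polar angle `ν`. -/
def proj (ν : ℝ) (x : Plane) : ℝ := x 0 * Real.cos ν + x 1 * Real.sin ν

@[simp] lemma pt_zero (p φ t : ℝ) : pt p φ t 0 = p * Real.cos φ - t * Real.sin φ := by simp [pt]

@[simp] lemma pt_one (p φ t : ℝ) : pt p φ t 1 = p * Real.sin φ + t * Real.cos φ := by simp [pt]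

lemma plane_ext {x y : Plane} (h0 : x 0 = y 0) (h1 : x 1 = y 1) : x = y := by
  ext i; fin_cases i
  · exact h0
  · exact h1

lemma proj_pt (p φ t ν : ℝ) :
    proj ν (pt p φ t) = p * Real.cos (ν - φ) + t * Real.sin (ν - φ) := by
  simp only [proj, pt_zero, pt_one, Real.cos_sub, Real.sin_sub]; ring

/-- This change of frame allows a vertex or chord endpoint to be read in the frame of a side normal,
where membership in the side is a bound on one coordinate. -/
lemma pt_rotate (p φ t δ : ℝ) :
    pt p φ t = pt (p * Real.cos δ + t * Real.sin δ) (φ + δ) (t * Real.cos δ - p * Real.sin δ) := by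
  apply plane_ext
  · simp only [pt_zero, Real.cos_add, Real.sin_add]
    linear_combination (-(p * Real.cos φ - t * Real.sin φ)) * Real.sin_sq_add_cos_sq δ
  · simp only [pt_one, Real.cos_add, Real.sin_add]
    linear_combination (-(p * Real.sin φ + t * Real.cos φ)) * Real.sin_sq_add_cos_sq δ

lemma pt_add_pi (p φ t : ℝ) : pt p (φ + Real.pi) t = pt (-p) φ (-t) := by
  apply plane_ext <;> simp

lemma pt_add_two_pi (p φ t : ℝ) : pt p (φ + 2 * Real.pi) t = pt p φ t := by
  apply plane_ext <;> simp

lemma pt_combo (a b p q φ t u : ℝ) :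
    a • pt p φ t + b • pt q φ u = pt (a * p + b * q) φ (a * t + b * u) := by
  apply plane_ext <;> simp <;> ring

lemma dist_pt (p φ t q ψ u : ℝ) :
    dist (pt p φ t) (pt q ψ u) = Real.sqrt ((pt p φ t 0 - pt q ψ u 0) ^ 2 +
      (pt p φ t 1 - pt q ψ u 1) ^ 2) := by
  rw [EuclideanSpace.dist_eq, Fin.sum_univ_two, Real.dist_eq, Real.dist_eq, sq_abs, sq_abs]

lemma isometry_pt (p φ : ℝ) : Isometry (pt p φ) := by
  refine Isometry.of_dist_eq fun t u => ?_
  rw [dist_pt, Real.dist_eq, ← Real.sqrt_sq_eq_abs]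
  congr 1
  simp only [pt_zero, pt_one]
  linear_combination (t - u) ^ 2 * Real.sin_sq_add_cos_sq φ

lemma line_eq_range (p φ : ℝ) : line p φ = Set.range (pt p φ) := by
  ext x
  simp only [line, Set.mem_ofPred_eq, Set.mem_range]
  constructor
  · intro h
    refine ⟨x 1 * Real.cos φ - x 0 * Real.sin φ, ?_⟩
    apply plane_ext
    · simp only [pt_zero, ← h]; linear_combination x 0 * Real.sin_sq_add_cos_sq φ
    · simp only [pt_one, ← h]; linear_combination x 1 * Real.sin_sq_add_cos_sq φ
  · rintro ⟨t, rfl⟩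
    simp only [pt_zero, pt_one]; linear_combination p * Real.sin_sq_add_cos_sq φ

/-! ### The polygon -/

lemma vertex_eq_pt (n : ℕ) (r θ : ℝ) (i : ℕ) :
    vertex n r θ i = pt r (θ + 2 * (Real.pi / n) * i) 0 := by
  have h : θ + 2 * Real.pi * i / n = θ + 2 * (Real.pi / n) * i := by ring
  apply plane_ext <;> simp [vertex, h]

lemma convex_polygon (n : ℕ) (r θ : ℝ) : Convex ℝ (polygon n r θ) := convex_convexHull ℝ _

lemma isCompact_polygon (n : ℕ) (r θ : ℝ) : IsCompact (polygon n r θ) :=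
  (Set.finite_range _).isCompact_convexHull ℝ

/-- Doubled, this says that reducing an index mod n changes the polar angle by full turns, so
vertices and sides can be indexed by all integers. -/
lemma int_mul_step {n : ℕ} (hn : n ≠ 0) (m : ℤ) :
    Real.pi / n * m = Real.pi / n * (m % n : ℤ) + (m / n : ℤ) * Real.pi := by
  have hn' : (n : ℝ) ≠ 0 := by exact_mod_cast hn
  have h : (m : ℝ) = (m % n : ℤ) + n * (m / n : ℤ) := by exact_mod_cast (Int.emod_add_mul_ediv m n).symm
  field_simp
  nth_rewrite 1 [h]
  ring

lemma vertex_mem {n : ℕ} (hn : n ≠ 0) (r θ : ℝ) (j : ℤ) :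
    pt r (θ + 2 * (Real.pi / n) * j) 0 ∈ polygon n r θ := by
  have h0 : (0 : ℤ) < n := by exact_mod_cast Nat.pos_of_ne_zero hn
  have h1 := Int.emod_nonneg j h0.ne'
  have h2 := Int.emod_lt_of_pos j h0
  apply subset_convexHull ℝ
  refine ⟨⟨(j % n).toNat, by omega⟩, ?_⟩
  have h3 : (((j % n).toNat : ℕ) : ℝ) = ((j % n : ℤ) : ℝ) := by
    exact_mod_cast congrArg (Int.cast (R := ℝ)) (Int.toNat_of_nonneg h1)
  have h4 : θ + 2 * (Real.pi / n) * j =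
      (θ + 2 * (Real.pi / n) * (j % n : ℤ)) + (j / n : ℤ) * (2 * Real.pi) := by
    linear_combination 2 * int_mul_step hn j
  simp only [vertex_eq_pt, h3, h4]
  apply plane_ext <;> simp [Real.cos_add_int_mul_two_pi, Real.sin_add_int_mul_two_pi]

/-- In the frame of the outer normal of side j, the vertices j and j+1 have tangential coordinates ∓
r sin(π/n); the points between them are convex combinations. -/
lemma side_mem {n : ℕ} (hn : 3 ≤ n) {r : ℝ} (hr : 0 < r) (θ : ℝ) (j : ℤ) {y : ℝ}
    (hy : |y| ≤ r * Real.sin (Real.pi / n)) :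
    pt (r * Real.cos (Real.pi / n)) (θ + Real.pi / n + 2 * (Real.pi / n) * j) y
      ∈ polygon n r θ := by
  have hn0 : n ≠ 0 := by omega
  have hpi : Real.pi / n < Real.pi := by
    have : (1 : ℝ) < n := by exact_mod_cast (by omega : 1 < n)
    exact div_lt_self Real.pi_pos this
  have hc0 : 0 < Real.pi / n := div_pos Real.pi_pos (by exact_mod_cast (by omega : 0 < n))
  have hsin : 0 < Real.sin (Real.pi / n) := Real.sin_pos_of_pos_of_lt_pi hc0 hpi
  have h1 := vertex_mem hn0 r θ j
  have h2 := vertex_mem hn0 r θ (j + 1)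
  rw [pt_rotate _ _ _ (Real.pi / n)] at h1
  rw [pt_rotate _ _ _ (-(Real.pi / n))] at h2
  set c := Real.pi / n
  have e1 : θ + 2 * c * j + c = θ + c + 2 * c * j := by ring
  have e2 : θ + 2 * c * ((j + 1 : ℤ) : ℝ) + -c = θ + c + 2 * c * j := by push_cast; ring
  rw [e1] at h1
  rw [e2] at h2
  rw [abs_le] at hy
  have hne : r * Real.sin c ≠ 0 := (mul_pos hr hsin).ne'
  have hpos : 0 < 2 * (r * Real.sin c) := by positivity
  have := convex_polygon n r θ h1 h2 (a := (r * Real.sin c - y) / (2 * (r * Real.sin c)))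
    (b := (y + r * Real.sin c) / (2 * (r * Real.sin c)))
    (div_nonneg (by linarith) hpos.le) (div_nonneg (by linarith) hpos.le)
    (by field_simp; ring)
  rw [pt_combo] at this
  convert this using 2
  · simp; field_simp; ring
  · simp; field_simp; ring

/-- With c = π/n and q = m mod n, the difference of the two sides is 2 sin(cq) sin(cq - ψ). For q ≠
0, c ≤ cq ≤ π - c and |ψ| ≤ c make both factors nonnegative. -/
lemma cos_int_mul_sub_le {n : ℕ} (hn : n ≠ 0) (m : ℤ) {ψ : ℝ} (hψ : |ψ| ≤ Real.pi / n) :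
    Real.cos (2 * (Real.pi / n) * m - ψ) ≤ Real.cos ψ := by
  have hnpos : (0 : ℝ) < n := by exact_mod_cast Nat.pos_of_ne_zero hn
  have h0 : (0 : ℤ) < n := by exact_mod_cast Nat.pos_of_ne_zero hn
  have h1 := Int.emod_nonneg m h0.ne'
  have h2 := Int.emod_lt_of_pos m h0
  have hc0 : 0 < Real.pi / n := div_pos Real.pi_pos hnpos
  have h4 : 2 * (Real.pi / n) * m - ψ =
      (2 * (Real.pi / n) * (m % n : ℤ) - ψ) + (m / n : ℤ) * (2 * Real.pi) := by
    linear_combination 2 * int_mul_step hn m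
  rw [h4, Real.cos_add_int_mul_two_pi]
  have hcn : Real.pi / n * n = Real.pi := by field_simp
  generalize m % (n : ℤ) = q at h1 h2
  set c := Real.pi / n
  rcases h1.eq_or_lt with rfl | hq
  · simp
  · have key : Real.cos ψ - Real.cos (2 * c * q - ψ) = 2 * (Real.sin (c * q) * Real.sin (c * q - ψ)) := by
      rw [Real.cos_sub_cos]
      have a1 : (ψ + (2 * c * q - ψ)) / 2 = c * q := by ring
      have a2 : (ψ - (2 * c * q - ψ)) / 2 = -(c * q - ψ) := by ring
      rw [a1, a2, Real.sin_neg]; ring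
    have q1 : (1 : ℝ) ≤ q := by exact_mod_cast hq
    have q2 : (q : ℝ) ≤ n - 1 := by
      have : q ≤ n - 1 := by omega
      exact_mod_cast this
    rw [abs_le] at hψ
    have b1 : c ≤ c * q := by nlinarith
    have b2 : c * q ≤ Real.pi - c := by nlinarith
    have := Real.sin_nonneg_of_nonneg_of_le_pi (x := c * q) (by linarith) (by linarith)
    have := Real.sin_nonneg_of_nonneg_of_le_pi (x := c * q - ψ) (by linarith) (by linarith)
    have := mul_nonneg ‹0 ≤ Real.sin (c * q)› this
    linarith

lemma proj_le_of_vertices {n : ℕ} {r θ ν B : ℝ}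
    (h : ∀ i : Fin n, proj ν (vertex n r θ i) ≤ B) {x : Plane} (hx : x ∈ polygon n r θ) :
    proj ν x ≤ B := by
  have hlin : IsLinearMap ℝ (proj ν) := ⟨fun x y => by simp [proj]; ring, fun a x => by
    simp [proj]; ring⟩
  have hsub : polygon n r θ ⊆ {x | proj ν x ≤ B} := by
    apply convexHull_min
    · rintro _ ⟨i, rfl⟩; exact h i
    · exact convex_halfSpace_le hlin B
  exact hsub hx

/-- In a direction at angle at most `π / n` from a vertex, this vertex is extreme. -/
lemma proj_le_vertex {n : ℕ} (hn : n ≠ 0) {r : ℝ} (hr : 0 < r) (θ : ℝ) (j : ℤ) {ψ : ℝ}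
    (hψ : |ψ| ≤ Real.pi / n) {x : Plane} (hx : x ∈ polygon n r θ) :
    proj (θ + 2 * (Real.pi / n) * j + ψ) x ≤ r * Real.cos ψ := by
  refine proj_le_of_vertices (fun i => ?_) hx
  rw [vertex_eq_pt, proj_pt, zero_mul, add_zero]
  refine mul_le_mul_of_nonneg_left ?_ hr.le
  have h := cos_int_mul_sub_le hn (i - j) hψ
  rw [← Real.cos_neg] at h
  have e : θ + 2 * (Real.pi / n) * j + ψ - (θ + 2 * (Real.pi / n) * (i : ℕ)) =
      -(2 * (Real.pi / n) * ((i - j : ℤ) : ℝ) - ψ) := by push_cast; ring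
  rwa [e]

lemma proj_le_apothem {n : ℕ} (hn : n ≠ 0) {r : ℝ} (hr : 0 < r) (θ : ℝ) (j : ℤ)
    {x : Plane} (hx : x ∈ polygon n r θ) :
    proj (θ + Real.pi / n + 2 * (Real.pi / n) * j) x ≤ r * Real.cos (Real.pi / n) := by
  have hnpos : (0 : ℝ) < n := by exact_mod_cast Nat.pos_of_ne_zero hn
  have hc0 : 0 < Real.pi / n := div_pos Real.pi_pos hnpos
  have := proj_le_vertex hn hr θ j (ψ := Real.pi / n) (abs_of_pos hc0).le hx
  convert this using 2; ring

lemma proj_le_radius {n : ℕ} {r : ℝ} (hr : 0 < r) (θ ν : ℝ)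
    {x : Plane} (hx : x ∈ polygon n r θ) : proj ν x ≤ r := by
  refine proj_le_of_vertices (fun i => ?_) hx
  rw [vertex_eq_pt, proj_pt, zero_mul, add_zero]
  exact mul_le_of_le_one_right hr.le (Real.cos_le_one _)

lemma pt_bounds {n : ℕ} {r : ℝ} (hr : 0 < r) {θ p φ t : ℝ} (h : pt p φ t ∈ polygon n r θ) :
    |p| ≤ r ∧ |t| ≤ r := by
  have h1 := proj_le_radius hr θ φ h
  have h2 := proj_le_radius hr θ (φ + Real.pi) h
  have h3 := proj_le_radius hr θ (φ + Real.pi / 2) h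
  have h4 := proj_le_radius hr θ (φ - Real.pi / 2) h
  simp only [proj_pt, sub_self, add_sub_cancel_left, sub_sub_cancel_left, Real.cos_zero,
    Real.sin_zero, Real.cos_pi, Real.sin_pi, Real.cos_pi_div_two, Real.sin_pi_div_two,
    Real.cos_neg, Real.sin_neg] at h1 h2 h3 h4
  constructor <;> rw [abs_le] <;> constructor <;> linarith

/-! ### Chords -/

/-- The chord on `g(p, φ)` has length at least `ℓ`. -/
def ChordAt (n : ℕ) (r θ ℓ φ p : ℝ) : Prop :=
  ∃ t₁ t₂, ℓ ≤ t₂ - t₁ ∧ pt p φ t₁ ∈ polygon n r θ ∧ pt p φ t₂ ∈ polygon n r θ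

/-- The chord on `g(p, φ)` is longer than `s`. -/
def LongChord (n : ℕ) (r θ s φ p : ℝ) : Prop :=
  ∃ t₁ t₂, s < t₂ - t₁ ∧ pt p φ t₁ ∈ polygon n r θ ∧ pt p φ t₂ ∈ polygon n r θ

lemma LongChord.chordAt {n : ℕ} {r θ s φ p : ℝ} (h : LongChord n r θ s φ p) :
    ChordAt n r θ s φ p := by
  obtain ⟨t₁, t₂, h, h'⟩ := h
  exact ⟨t₁, t₂, h.le, h'⟩

lemma chordAt_add_pi {n : ℕ} {r θ ℓ φ p : ℝ} :
    ChordAt n r θ ℓ (φ + Real.pi) p ↔ ChordAt n r θ ℓ φ (-p) := by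
  simp only [ChordAt, pt_add_pi]
  constructor
  · rintro ⟨t₁, t₂, h, h1, h2⟩; exact ⟨-t₂, -t₁, by linarith, h2, h1⟩
  · rintro ⟨t₁, t₂, h, h1, h2⟩; exact ⟨-t₂, -t₁, by linarith, by simpa using h2, by simpa using h1⟩

lemma longChord_add_pi {n : ℕ} {r θ s φ p : ℝ} :
    LongChord n r θ s (φ + Real.pi) p ↔ LongChord n r θ s φ (-p) := by
  simp only [LongChord, pt_add_pi]
  constructor
  · rintro ⟨t₁, t₂, h, h1, h2⟩; exact ⟨-t₂, -t₁, by linarith, h2, h1⟩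
  · rintro ⟨t₁, t₂, h, h1, h2⟩; exact ⟨-t₂, -t₁, by linarith, by simpa using h2, by simpa using h1⟩

/-- Chord length is concave in p: convex combinations of the endpoints of two parallel chords stay
in the polygon. Strictness survives as long as the longer chord has positive weight. -/
lemma LongChord.combo {n : ℕ} {r θ s φ p q a b : ℝ} (h : LongChord n r θ s φ p)
    (h' : ChordAt n r θ s φ q) (ha : 0 < a) (hb : 0 ≤ b) (hab : a + b = 1) :
    LongChord n r θ s φ (a * p + b * q) := by
  obtain ⟨t₁, t₂, h0, h1, h2⟩ := h
  obtain ⟨u₁, u₂, k0, k1, k2⟩ := h'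
  refine ⟨a * t₁ + b * u₁, a * t₂ + b * u₂, ?_, ?_, ?_⟩
  · have : s = a * s + b * s := by rw [← add_mul, hab, one_mul]
    nlinarith
  · rw [← pt_combo]; exact convex_polygon n r θ h1 k1 ha.le hb hab
  · rw [← pt_combo]; exact convex_polygon n r θ h2 k2 ha.le hb hab

/-- `e` is the largest `p` for which the chord on `g(p, φ)` has length `s`. -/
def IsUpper (n : ℕ) (r θ s φ e : ℝ) : Prop :=
  (∀ p, ChordAt n r θ s φ p → p ≤ e) ∧ ChordAt n r θ s φ e ∧ ∃ p, LongChord n r θ s φ p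

/-- Either `e` is the largest `p` for which the chord on `g(p, φ)` has length `s`, or all chords
in this direction are shorter than `s` and `e = 0`. -/
def Regular (n : ℕ) (r θ s φ e : ℝ) : Prop :=
  IsUpper n r θ s φ e ∨ ((∀ p, ¬ ChordAt n r θ s φ p) ∧ e = 0)

/-- The set is squeezed between the open and the closed interval from -e' to e. The strictly long
chord required by `IsUpper` is essential: if all chords between the extremes had length exactly s,
as between parallel sides, the set would be empty. -/
lemma volume_longChord {n : ℕ} {r θ s φ e e' : ℝ} (h : Regular n r θ s φ e)
    (h' : Regular n r θ s (φ + Real.pi) e') :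
    (volume {p | LongChord n r θ s φ p}).toReal = e + e' := by
  rcases h with ⟨h1, h2, p₀, h3⟩ | ⟨hs, rfl⟩
  · rcases h' with ⟨k1, k2, -⟩ | ⟨hs', rfl⟩
    · rw [chordAt_add_pi] at k2
      have k1' : ∀ p, ChordAt n r θ s φ p → -e' ≤ p := fun p hp => by
        have := k1 (-p) (chordAt_add_pi.2 (by simpa using hp)); linarith
      have hp1 := h1 _ h3.chordAt
      have hp2 := k1' _ h3.chordAt
      have hsub1 : {p | LongChord n r θ s φ p} ⊆ Set.Icc (-e') e :=
        fun p hp => ⟨k1' p hp.chordAt, h1 p hp.chordAt⟩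
      -- Any p strictly inside is a combination of the long position `p₀` with whichever extreme
      -- lies on the same side of `p₀`.
      have hsub2 : Set.Ioo (-e') e ⊆ {p | LongChord n r θ s φ p} := by
        rintro p ⟨q1, q2⟩
        rcases le_total p p₀ with hle | hle
        · have hpos : 0 < p₀ + e' := by linarith
          have := h3.combo k2 (a := (p + e') / (p₀ + e')) (b := (p₀ - p) / (p₀ + e'))
            (div_pos (by linarith) hpos) (div_nonneg (by linarith) hpos.le) (by field_simp; ring)
          have e : (p + e') / (p₀ + e') * p₀ + (p₀ - p) / (p₀ + e') * -e' = p := by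
            field_simp; ring
          rwa [e] at this
        · have hpos : 0 < e - p₀ := by linarith
          have := h3.combo h2 (a := (e - p) / (e - p₀)) (b := (p - p₀) / (e - p₀))
            (div_pos (by linarith) hpos) (div_nonneg (by linarith) hpos.le) (by field_simp; ring)
          have e : (e - p) / (e - p₀) * p₀ + (p - p₀) / (e - p₀) * e = p := by
            field_simp; ring
          rwa [e] at this
      have hv : volume {p | LongChord n r θ s φ p} = ENNReal.ofReal (e + e') := by
        apply le_antisymm
        · refine (measure_mono hsub1).trans ?_
          rw [Real.volume_Icc, sub_neg_eq_add]
        · refine le_trans ?_ (measure_mono hsub2)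
          rw [Real.volume_Ioo, sub_neg_eq_add]
      rw [hv, ENNReal.toReal_ofReal (by linarith)]
    · exact absurd (chordAt_add_pi.2 (by simpa using h2)) (hs' (-e))
  · rcases h' with ⟨-, k2, -⟩ | ⟨hs', rfl⟩
    · exact absurd (chordAt_add_pi.1 k2) (hs _)
    · have : {p | LongChord n r θ s φ p} = ∅ := by
        ext p; simpa using fun hp => hs p hp.chordAt
      simp [this]

/-- The signed distance from the origin of the chord of length `s` between two lines at distance
`ρ` from the origin whose normals make the angles `±β` with an axis, `ψ` being the angle between
this axis and the normal of the chord. -/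
def chordDist (ρ β s ψ : ℝ) : ℝ :=
  (2 * ρ * Real.sin β * Real.cos ψ - s * Real.sin (β - ψ) * Real.sin (β + ψ)) / Real.sin (2 * β)

/-! ### The extremal chord between two given sides -/

section

variable {n : ℕ} {r : ℝ} (θ : ℝ) (j : ℤ) (κ : ℕ) {ψ s p : ℝ}

/-- With β = κπ/n, weight the inequality of side j at t₁ by sin(β - ψ) and that of side j+κ at t₂ by
sin(β + ψ); in the sum, t₁ and t₂ occur only through t₂ - t₁ ≥ s. There is no division by sin 2β, so
parallel sides are covered. -/
lemma chord_ineq (hn : n ≠ 0) (hr : 0 < r)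
    (h1 : 0 ≤ Real.sin (κ * (Real.pi / n) - ψ)) (h2 : 0 ≤ Real.sin (κ * (Real.pi / n) + ψ))
    (h : ChordAt n r θ s (θ + Real.pi / n + (2 * j + κ) * (Real.pi / n) + ψ) p) :
    p * Real.sin (2 * (κ * (Real.pi / n)))
      + s * Real.sin (κ * (Real.pi / n) - ψ) * Real.sin (κ * (Real.pi / n) + ψ)
      ≤ 2 * (r * Real.cos (Real.pi / n)) * Real.sin (κ * (Real.pi / n)) * Real.cos ψ := by
  obtain ⟨t₁, t₂, hst, hp1, hp2⟩ := h
  have k1 := proj_le_apothem hn hr θ j hp1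
  have k2 := proj_le_apothem hn hr θ (j + κ) hp2
  rw [proj_pt] at k1 k2
  set c := Real.pi / n
  have e1 : θ + c + 2 * c * j - (θ + c + (2 * j + κ) * c + ψ) = -(κ * c + ψ) := by ring
  have e2 : θ + c + 2 * c * ((j + κ : ℤ) : ℝ) - (θ + c + (2 * j + κ) * c + ψ) = κ * c - ψ := by
    push_cast; ring
  rw [e1, Real.cos_neg, Real.sin_neg] at k1
  rw [e2] at k2
  set β := κ * c
  have m1 := mul_le_mul_of_nonneg_right k1 h1
  have m2 := mul_le_mul_of_nonneg_right k2 h2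
  have m3 := mul_le_mul_of_nonneg_right hst (mul_nonneg h1 h2)
  have i1 : Real.sin (2 * β) = Real.sin (β - ψ) * Real.cos (β + ψ) + Real.cos (β - ψ) * Real.sin (β + ψ) := by
    rw [← Real.sin_add]; congr 1; ring
  have i2 : 2 * Real.sin β * Real.cos ψ = Real.sin (β - ψ) + Real.sin (β + ψ) := by
    rw [Real.sin_sub, Real.sin_add]; ring
  have i3 : 2 * (r * Real.cos c) * Real.sin β * Real.cos ψ
      = r * Real.cos c * (Real.sin (β - ψ) + Real.sin (β + ψ)) := by rw [← i2]; ring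
  rw [i1, i3]
  linarith

lemma le_chordDist (hn : n ≠ 0) (hr : 0 < r) (h0 : 0 < Real.sin (2 * (κ * (Real.pi / n))))
    (h1 : 0 ≤ Real.sin (κ * (Real.pi / n) - ψ)) (h2 : 0 ≤ Real.sin (κ * (Real.pi / n) + ψ))
    (h : ChordAt n r θ s (θ + Real.pi / n + (2 * j + κ) * (Real.pi / n) + ψ) p) :
    p ≤ chordDist (r * Real.cos (Real.pi / n)) (κ * (Real.pi / n)) s ψ := by
  rw [chordDist, le_div_iff₀ h0]
  linarith [chord_ineq θ j κ hn hr h1 h2 h]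

/-- At this distance the lines carrying sides j and j+κ cut off exactly length s. The hypotheses
`a1`, `a2`, `b1`, `b2` say that the two intersection points have tangential coordinates of absolute
value at most r sin(π/n), hence lie on the sides. -/
lemma chordAt_chordDist (hn : 3 ≤ n) (hr : 0 < r)
    (hβ : 0 < Real.sin (κ * (Real.pi / n))) (hβ' : 0 < Real.cos (κ * (Real.pi / n)))
    (h1 : 0 < Real.sin (κ * (Real.pi / n) - ψ)) (h2 : 0 < Real.sin (κ * (Real.pi / n) + ψ))
    (a1 : 2 * r * Real.sin (κ * (Real.pi / n)) * Real.sin (κ * (Real.pi / n) - Real.pi / n)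
      ≤ s * Real.sin (κ * (Real.pi / n) - ψ))
    (a2 : 2 * r * Real.sin (κ * (Real.pi / n)) * Real.sin (κ * (Real.pi / n) - Real.pi / n)
      ≤ s * Real.sin (κ * (Real.pi / n) + ψ))
    (b1 : s * Real.sin (κ * (Real.pi / n) - ψ) ≤
      2 * r * Real.sin (κ * (Real.pi / n)) * Real.sin (κ * (Real.pi / n) + Real.pi / n))
    (b2 : s * Real.sin (κ * (Real.pi / n) + ψ) ≤
      2 * r * Real.sin (κ * (Real.pi / n)) * Real.sin (κ * (Real.pi / n) + Real.pi / n)) :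
    ChordAt n r θ s (θ + Real.pi / n + (2 * j + κ) * (Real.pi / n) + ψ)
      (chordDist (r * Real.cos (Real.pi / n)) (κ * (Real.pi / n)) s ψ) := by
  have k1 := fun y => side_mem (y := y) hn hr θ j
  have k2 := fun y => side_mem (y := y) hn hr θ (j + κ)
  set c := Real.pi / n
  set β := κ * c with hβdef
  set ρ := r * Real.cos c with hρ
  set D := chordDist ρ β s ψ with hD
  have hsin2 : Real.sin (2 * β) = 2 * Real.sin β * Real.cos β := Real.sin_two_mul β
  have hpos : 0 < 2 * Real.sin β * Real.cos β := by positivity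
  have hD' : D * (2 * Real.sin β * Real.cos β)
      = 2 * ρ * Real.sin β * Real.cos ψ - s * Real.sin (β - ψ) * Real.sin (β + ψ) := by
    rw [hD, chordDist, hsin2]; field_simp
  have ip : Real.cos ψ = Real.cos β * Real.cos (β - ψ) + Real.sin β * Real.sin (β - ψ) := by
    rw [← Real.cos_sub]; congr 1; ring
  have im : Real.cos ψ = Real.cos β * Real.cos (β + ψ) + Real.sin β * Real.sin (β + ψ) := by
    rw [← Real.cos_sub, ← Real.cos_neg]; congr 1; ring
  have i1 : 2 * Real.sin β * Real.cos β = Real.sin (β - ψ) * Real.cos (β + ψ) + Real.cos (β - ψ) * Real.sin (β + ψ) := by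
    rw [← hsin2, ← Real.sin_add]; congr 1; ring
  have i2 : 2 * Real.sin β * Real.cos ψ = Real.sin (β - ψ) + Real.sin (β + ψ) := by
    rw [Real.sin_sub, Real.sin_add]; ring
  have y2 : (ρ * Real.cos (β - ψ) - D) / Real.sin (β - ψ) * (2 * Real.sin β * Real.cos β)
      = s * Real.sin (β + ψ) - 2 * ρ * Real.sin β ^ 2 := by
    field_simp
    linear_combination -hD' - 2 * ρ * Real.sin β * ip
  have y1 : (D - ρ * Real.cos (β + ψ)) / Real.sin (β + ψ) * (2 * Real.sin β * Real.cos β)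
      = -(s * Real.sin (β - ψ) - 2 * ρ * Real.sin β ^ 2) := by
    field_simp
    linear_combination hD' + 2 * ρ * Real.sin β * im
  rw [Real.sin_add β c] at b1 b2
  rw [Real.sin_sub β c] at a1 a2
  -- The parameters at which the line meets the lines carrying sides j and j+κ.
  refine ⟨(D * Real.cos (β + ψ) - ρ) / Real.sin (β + ψ), (ρ - D * Real.cos (β - ψ)) / Real.sin (β - ψ),
    ?_, ?_, ?_⟩
  · apply le_of_eq
    field_simp
    have i3 : 2 * ρ * Real.sin β * Real.cos ψ = ρ * (Real.sin (β - ψ) + Real.sin (β + ψ)) := by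
      rw [← i2]; ring
    rw [i1, i3] at hD'
    linarith
  · rw [pt_rotate _ _ _ (-(β + ψ))]
    have hb : |(D - ρ * Real.cos (β + ψ)) / Real.sin (β + ψ)| ≤ r * Real.sin c := by
      rw [abs_le]
      constructor
      · refine le_of_mul_le_mul_right ?_ hpos
        rw [y1, hρ]; linarith
      · refine le_of_mul_le_mul_right ?_ hpos
        rw [y1, hρ]; linarith
    convert k1 _ hb using 2
    · rw [Real.cos_neg, Real.sin_neg]; field_simp; ring
    · rw [hβdef]; ring
    · rw [Real.cos_neg, Real.sin_neg]; field_simp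
      linear_combination D * Real.sin_sq_add_cos_sq (β + ψ)
  · rw [pt_rotate _ _ _ (β - ψ)]
    have hb : |(ρ * Real.cos (β - ψ) - D) / Real.sin (β - ψ)| ≤ r * Real.sin c := by
      rw [abs_le]
      constructor
      · refine le_of_mul_le_mul_right ?_ hpos
        rw [y2, hρ]; linarith
      · refine le_of_mul_le_mul_right ?_ hpos
        rw [y2, hρ]; linarith
    convert k2 _ hb using 2
    · field_simp; ring
    · rw [hβdef]; push_cast; ring
    · field_simp
      linear_combination -D * Real.sin_sq_add_cos_sq (β - ψ)

lemma isUpper_chordDist (hn : 3 ≤ n) (hr : 0 < r)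
    (hβ : 0 < Real.sin (κ * (Real.pi / n))) (hβ' : 0 < Real.cos (κ * (Real.pi / n)))
    (h1 : 0 < Real.sin (κ * (Real.pi / n) - ψ)) (h2 : 0 < Real.sin (κ * (Real.pi / n) + ψ))
    (a1 : 2 * r * Real.sin (κ * (Real.pi / n)) * Real.sin (κ * (Real.pi / n) - Real.pi / n)
      ≤ s * Real.sin (κ * (Real.pi / n) - ψ))
    (a2 : 2 * r * Real.sin (κ * (Real.pi / n)) * Real.sin (κ * (Real.pi / n) - Real.pi / n)
      ≤ s * Real.sin (κ * (Real.pi / n) + ψ))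
    (b1 : s * Real.sin (κ * (Real.pi / n) - ψ) <
      2 * r * Real.sin (κ * (Real.pi / n)) * Real.sin (κ * (Real.pi / n) + Real.pi / n))
    (b2 : s * Real.sin (κ * (Real.pi / n) + ψ) <
      2 * r * Real.sin (κ * (Real.pi / n)) * Real.sin (κ * (Real.pi / n) + Real.pi / n)) :
    IsUpper n r θ s (θ + Real.pi / n + (2 * j + κ) * (Real.pi / n) + ψ)
      (chordDist (r * Real.cos (Real.pi / n)) (κ * (Real.pi / n)) s ψ) := by
  refine ⟨fun p hp => le_chordDist θ j κ (by omega) hr ?_ h1.le h2.le hp,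
    chordAt_chordDist θ j κ hn hr hβ hβ' h1 h2 a1 a2 b1.le b2.le, ?_⟩
  · rw [Real.sin_two_mul]; positivity
  set A := 2 * r * Real.sin (κ * (Real.pi / n)) * Real.sin (κ * (Real.pi / n) + Real.pi / n)
  rw [← lt_div_iff₀ h1] at b1
  rw [← lt_div_iff₀ h2] at b2
  -- Strictness of the outer bounds leaves room for a length `s'` slightly above s; its extremal
  -- chord is the strictly long one.
  obtain ⟨s', hs1, hs2⟩ := exists_between (lt_min b1 b2)
  have c1 := (hs2.trans_le (min_le_left _ _)).le
  have c2 := (hs2.trans_le (min_le_right _ _)).le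
  rw [le_div_iff₀ h1] at c1
  rw [le_div_iff₀ h2] at c2
  obtain ⟨t₁, t₂, ht, ht'⟩ := chordAt_chordDist (s := s') θ j κ hn hr hβ hβ' h1 h2
    (a1.trans (by gcongr)) (a2.trans (by gcongr)) c1 c2
  exact ⟨_, t₁, t₂, hs1.trans_le ht, ht'⟩

/-- The width bound: chords in a direction are controlled by the width of the polygon orthogonal
to a side. -/
lemma chordAt_mul_sin_le (hn : n ≠ 0) (hr : 0 < r) {φ γ : ℝ} (hγ : 0 ≤ Real.sin γ)
    (hφ : φ = θ + Real.pi / n + 2 * (Real.pi / n) * j - γ ∨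
      φ = θ + Real.pi / n + 2 * (Real.pi / n) * j + γ)
    (h : ChordAt n r θ s φ p) :
    s * Real.sin γ ≤ r * Real.cos (Real.pi / n) + r := by
  obtain ⟨t₁, t₂, hst, hp1, hp2⟩ := h
  have m3 := mul_le_mul_of_nonneg_right hst hγ
  rcases hφ with rfl | rfl
  · have k1 := proj_le_radius hr θ (θ + Real.pi / n + 2 * (Real.pi / n) * j + Real.pi) hp1
    have k2 := proj_le_apothem hn hr θ j hp2
    rw [proj_pt] at k1 k2
    rw [sub_sub_cancel] at k2
    have e : θ + Real.pi / n + 2 * (Real.pi / n) * j + Real.pi -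
      (θ + Real.pi / n + 2 * (Real.pi / n) * j - γ) = γ + Real.pi := by ring
    rw [e, Real.cos_add_pi, Real.sin_add_pi] at k1
    linarith
  · have k1 := proj_le_apothem hn hr θ j hp1
    have k2 := proj_le_radius hr θ (θ + Real.pi / n + 2 * (Real.pi / n) * j + Real.pi) hp2
    rw [proj_pt] at k1 k2
    rw [sub_add_cancel_left, Real.cos_neg, Real.sin_neg] at k1
    have e : θ + Real.pi / n + 2 * (Real.pi / n) * j + Real.pi -
      (θ + Real.pi / n + 2 * (Real.pi / n) * j + γ) = -γ + Real.pi := by ring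
    rw [e, Real.cos_add_pi, Real.sin_add_pi, Real.cos_neg, Real.sin_neg] at k2
    linarith

end


/-! ### Chord length and measurability -/

lemma chordLength_line (n : ℕ) (r θ p φ : ℝ) :
    chordLength n r θ (line p φ) = volume.real {t | pt p φ t ∈ polygon n r θ} := by
  have h : line p φ ∩ polygon n r θ = pt p φ '' {t | pt p φ t ∈ polygon n r θ} := by
    rw [line_eq_range]
    ext x; constructor
    · rintro ⟨⟨t, rfl⟩, h⟩; exact ⟨t, h, rfl⟩
    · rintro ⟨t, h, rfl⟩; exact ⟨⟨t, rfl⟩, h⟩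
  rw [chordLength, h, Measure.real, (isometry_pt p φ).hausdorffMeasure_image (Or.inl zero_le_one),
    hausdorffMeasure_real, Measure.real]

/-- The section is convex, so it contains the segment between any two of its points; conversely its
length is at most its diameter. -/
lemma chordLength_le_iff {n : ℕ} {r θ p φ s : ℝ} (hr : 0 < r) (hs : 0 ≤ s) :
    chordLength n r θ (line p φ) ≤ s ↔ ¬ LongChord n r θ s φ p := by
  rw [chordLength_line]
  set T := {t | pt p φ t ∈ polygon n r θ} with hT
  have hTb : T ⊆ Set.Icc (-r) r := fun t ht => abs_le.1 (pt_bounds hr ht).2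
  have hfin : volume T ≠ ⊤ := ((measure_mono hTb).trans_lt (by simp)).ne
  constructor
  · rintro h ⟨t₁, t₂, hst, h1, h2⟩
    have hsub : Set.Icc t₁ t₂ ⊆ T := by
      intro t ht
      have hpos : 0 < t₂ - t₁ := by linarith
      have := convex_polygon n r θ h1 h2 (a := (t₂ - t) / (t₂ - t₁)) (b := (t - t₁) / (t₂ - t₁))
        (div_nonneg (by linarith [ht.2]) hpos.le) (div_nonneg (by linarith [ht.1]) hpos.le)
        (by field_simp; ring)
      rw [pt_combo] at this
      show pt p φ t ∈ polygon n r θ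
      convert this using 2
      · field_simp; ring
      · field_simp; ring
    have := measureReal_mono hsub hfin
    rw [Real.volume_real_Icc_of_le (by linarith)] at this
    linarith
  · intro h
    have hd : Metric.ediam T ≤ ENNReal.ofReal s := by
      refine Metric.ediam_le fun x hx y hy => ?_
      rw [edist_dist]
      apply ENNReal.ofReal_le_ofReal
      rw [Real.dist_eq, abs_le]
      constructor
      · by_contra hc; exact h ⟨x, y, by linarith, hx, hy⟩
      · by_contra hc; exact h ⟨y, x, by linarith, hy, hx⟩
    exact ENNReal.toReal_le_of_le_ofReal hs ((Real.volume_le_diam T).trans hd)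

lemma measurableSet_of_isSigmaCompact {X : Type*} [TopologicalSpace X] [T2Space X]
    [MeasurableSpace X] [BorelSpace X] {A : Set X} (h : IsSigmaCompact A) : MeasurableSet A := by
  obtain ⟨C, hC, rfl⟩ := h
  exact MeasurableSet.iUnion fun i => (hC i).measurableSet

lemma measurableSet_nonempty (n : ℕ) (r θ : ℝ) :
    MeasurableSet {q : ℝ × ℝ | ∃ t, pt q.1 q.2 t ∈ polygon n r θ} := by
  have hcl : IsClosed {x : (ℝ × ℝ) × ℝ | pt x.1.1 x.1.2 x.2 ∈ polygon n r θ} :=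
    (isCompact_polygon n r θ).isClosed.preimage
      (f := fun x : (ℝ × ℝ) × ℝ => pt x.1.1 x.1.2 x.2) (by unfold pt; fun_prop)
  have := measurableSet_of_isSigmaCompact
    ((isSigmaCompact_univ.of_isClosed_subset hcl (Set.subset_univ _)).image continuous_fst)
  convert this using 1
  ext q; simp

/-- The strict inequality is a countable union of closed conditions with margin 1/(m+1). Closed sets
in a σ-compact space are σ-compact, and so are their projections. -/
lemma measurableSet_longChord (n : ℕ) (r θ s : ℝ) :
    MeasurableSet {q : ℝ × ℝ | LongChord n r θ s q.2 q.1} := by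
  have hcl : ∀ m : ℕ, IsClosed {x : (ℝ × ℝ) × ℝ × ℝ | s + 1 / ((m : ℝ) + 1) ≤ x.2.2 - x.2.1 ∧
      pt x.1.1 x.1.2 x.2.1 ∈ polygon n r θ ∧ pt x.1.1 x.1.2 x.2.2 ∈ polygon n r θ} := by
    intro m
    refine IsClosed.inter (isClosed_le (f := fun _ => s + 1 / ((m : ℝ) + 1))
      (g := fun x : (ℝ × ℝ) × ℝ × ℝ => x.2.2 - x.2.1) (by fun_prop) (by fun_prop))
      (IsClosed.inter ?_ ?_)
    · exact (isCompact_polygon n r θ).isClosed.preimage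
        (f := fun x : (ℝ × ℝ) × ℝ × ℝ => pt x.1.1 x.1.2 x.2.1) (by unfold pt; fun_prop)
    · exact (isCompact_polygon n r θ).isClosed.preimage
        (f := fun x : (ℝ × ℝ) × ℝ × ℝ => pt x.1.1 x.1.2 x.2.2) (by unfold pt; fun_prop)
  have := MeasurableSet.iUnion fun m =>
    measurableSet_of_isSigmaCompact
      ((isSigmaCompact_univ.of_isClosed_subset (hcl m) (Set.subset_univ _)).image continuous_fst)
  convert this using 1
  ext ⟨p, φ⟩
  simp only [LongChord, Set.mem_ofPred_eq, Set.mem_iUnion]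
  constructor
  · rintro ⟨t₁, t₂, h, h'⟩
    obtain ⟨m, hm⟩ := exists_nat_one_div_lt (sub_pos.2 h)
    exact ⟨m, ((p, φ), (t₁, t₂)), ⟨(by linarith : s + 1 / ((m : ℝ) + 1) ≤ t₂ - t₁), h'⟩, rfl⟩
  · rintro ⟨m, ⟨⟨p', φ'⟩, t₁, t₂⟩, ⟨h, h'⟩, heq⟩
    obtain ⟨rfl, rfl⟩ := Prod.mk.inj heq
    exact ⟨t₁, t₂, lt_of_lt_of_le (lt_add_of_pos_right s (by positivity)) h, h'⟩

/-- Fubini for sets of lines, the parameters being bounded. -/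
lemma volume_lines {Q : Set (ℝ × ℝ)} (hQ : MeasurableSet Q) {R : ℝ}
    (hb : ∀ q ∈ Q, |q.1| ≤ R) :
    (volume {q : ℝ × ℝ | (0 ≤ q.1 ∧ 0 ≤ q.2 ∧ q.2 < 2 * Real.pi) ∧ q ∈ Q} ≠ ⊤) ∧
    (∀ a b : ℝ, IntervalIntegrable
      (fun φ => (volume {p : ℝ | 0 ≤ p ∧ (p, φ) ∈ Q}).toReal) volume a b) ∧
    (volume {q : ℝ × ℝ | (0 ≤ q.1 ∧ 0 ≤ q.2 ∧ q.2 < 2 * Real.pi) ∧ q ∈ Q}).toReal =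
      ∫ φ in (0)..(2 * Real.pi), (volume {p : ℝ | 0 ≤ p ∧ (p, φ) ∈ Q}).toReal := by
  set S := {q : ℝ × ℝ | (0 ≤ q.1 ∧ 0 ≤ q.2 ∧ q.2 < 2 * Real.pi) ∧ q ∈ Q} with hS
  have hQ0 : MeasurableSet {q : ℝ × ℝ | 0 ≤ q.1 ∧ q ∈ Q} :=
    (measurableSet_le measurable_const measurable_fst).inter hQ
  have hsec : ∀ φ, volume {p : ℝ | 0 ≤ p ∧ (p, φ) ∈ Q} ≤ ENNReal.ofReal R := by
    intro φ
    refine (measure_mono (t := Set.Icc 0 R) fun p hp => ⟨hp.1, (le_abs_self p).trans (hb _ hp.2)⟩).trans ?_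
    rw [Real.volume_Icc, sub_zero]
  have hmeas : Measurable fun φ => volume {p : ℝ | 0 ≤ p ∧ (p, φ) ∈ Q} :=
    measurable_measure_prodMk_right hQ0
  have hint : ∀ a b : ℝ, IntervalIntegrable
      (fun φ => (volume {p : ℝ | 0 ≤ p ∧ (p, φ) ∈ Q}).toReal) volume a b := by
    intro a b
    refine (intervalIntegrable_const (c := (ENNReal.ofReal R).toReal)).mono_fun
      hmeas.ennreal_toReal.aestronglyMeasurable ?_
    filter_upwards with φ
    rw [Real.norm_of_nonneg ENNReal.toReal_nonneg, Real.norm_of_nonneg ENNReal.toReal_nonneg]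
    exact ENNReal.toReal_mono ENNReal.ofReal_ne_top (hsec φ)
  have hSm : MeasurableSet S :=
    ((measurableSet_le measurable_const measurable_fst).inter
      ((measurableSet_le measurable_const measurable_snd).inter
        (measurableSet_lt measurable_snd measurable_const))).inter hQ
  have hvol : volume S = ∫⁻ φ in Set.Ico 0 (2 * Real.pi), volume {p : ℝ | 0 ≤ p ∧ (p, φ) ∈ Q} := by
    rw [Measure.volume_eq_prod, Measure.prod_apply_symm hSm, ← lintegral_indicator measurableSet_Ico]
    congr 1
    ext φ
    by_cases h : φ ∈ Set.Ico 0 (2 * Real.pi)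
    · rw [Set.indicator_of_mem h]
      congr 1
      ext p
      simp only [hS, Set.mem_preimage, Set.mem_ofPred_eq]
      exact ⟨fun x => ⟨x.1.1, x.2⟩, fun x => ⟨⟨x.1, h.1, h.2⟩, x.2⟩⟩
    · rw [Set.indicator_of_notMem h]
      have : (fun x => (x, φ)) ⁻¹' S = ∅ := by
        ext p
        simp only [hS, Set.mem_preimage, Set.mem_ofPred_eq, Set.mem_empty_iff_false, iff_false]
        exact fun x => h ⟨x.1.2.1, x.1.2.2⟩
      rw [this, measure_empty]
  refine ⟨?_, hint, ?_⟩
  · rw [hvol]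
    refine ((lintegral_mono hsec).trans_lt ?_).ne
    simp [ENNReal.mul_lt_top]
  · rw [hvol, intervalIntegral.integral_of_le (by positivity), ← integral_Ico_eq_integral_Ioc,
      integral_toReal hmeas.aemeasurable]
    filter_upwards with φ
    exact (hsec φ).trans_lt ENNReal.ofReal_lt_top

/-- The integral over a period of a function that is, up to null sets, invariant under the
symmetries of the regular `n`-gon. -/
lemma integral_two_pi_eq {n : ℕ} (hn : n ≠ 0) {g G : ℝ → ℝ} (hg : Function.Periodic g (2 * Real.pi))
    (hint : ∀ a b, IntervalIntegrable g volume a b) (a : ℝ) {S : Set ℝ} (hS : S.Countable)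
    (h1 : ∀ j : ℤ, ∀ ψ ∈ Set.Ioo 0 (Real.pi / n), ψ ∉ S → g (a + 2 * j * (Real.pi / n) + ψ) = G ψ)
    (h2 : ∀ j : ℤ, ∀ ψ ∈ Set.Ioo 0 (Real.pi / n), ψ ∉ S → g (a + 2 * j * (Real.pi / n) - ψ) = G ψ) :
    ∫ φ in (0)..(2 * Real.pi), g φ = 2 * n * ∫ ψ in (0)..(Real.pi / n), G ψ := by
  have hnpos : (0 : ℝ) < n := by exact_mod_cast Nat.pos_of_ne_zero hn
  have hc0 : 0 < Real.pi / n := div_pos Real.pi_pos hnpos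
  have hcn : Real.pi / n * n = Real.pi := by field_simp
  set c := Real.pi / n
  have hae : ∀ᵐ ψ ∂(volume : Measure ℝ), ψ ∈ Set.uIoc 0 c → ψ ∈ Set.Ioo 0 c ∧ ψ ∉ S := by
    have hnull : volume (S ∪ {c}) = 0 := (hS.union (Set.countable_singleton c)).measure_zero _
    filter_upwards [measure_eq_zero_iff_ae_notMem.1 hnull] with ψ hψ hψ'
    rw [Set.uIoc_of_le hc0.le] at hψ'
    simp only [Set.union_singleton, Set.mem_insert_iff, not_or] at hψ
    exact ⟨⟨hψ'.1, lt_of_le_of_ne hψ'.2 hψ.1⟩, hψ.2⟩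
  have hpiece : ∀ j : ℕ, ∫ φ in (a + (2 * j - 1) * c)..(a + (2 * (j + 1 : ℕ) - 1) * c), g φ
      = 2 * ∫ ψ in (0)..c, G ψ := by
    intro j
    rw [← intervalIntegral.integral_add_adjacent_intervals (b := a + 2 * j * c) (hint _ _) (hint _ _)]
    have e1 : ∫ φ in (a + (2 * j - 1) * c)..(a + 2 * j * c), g φ = ∫ ψ in (0)..c, G ψ := by
      have := intervalIntegral.integral_comp_sub_left (a := 0) (b := c) g (a + 2 * j * c)
      rw [sub_zero] at this
      have e : a + 2 * j * c - c = a + (2 * j - 1) * c := by ring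
      rw [e] at this
      rw [← this]
      apply intervalIntegral.integral_congr_ae
      filter_upwards [hae] with ψ hψ hψ'
      have := h2 j ψ (hψ hψ').1 (hψ hψ').2
      exact_mod_cast this
    have e2 : ∫ φ in (a + 2 * j * c)..(a + (2 * (j + 1 : ℕ) - 1) * c), g φ = ∫ ψ in (0)..c, G ψ := by
      have := intervalIntegral.integral_comp_add_left (a := 0) (b := c) g (a + 2 * j * c)
      rw [add_zero] at this
      have e : a + 2 * j * c + c = a + (2 * (j + 1 : ℕ) - 1) * c := by push_cast; ring
      rw [e] at this
      rw [← this]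
      apply intervalIntegral.integral_congr_ae
      filter_upwards [hae] with ψ hψ hψ'
      have := h1 j ψ (hψ hψ').1 (hψ hψ').2
      exact_mod_cast this
    rw [e1, e2]; ring
  have hsum := intervalIntegral.sum_integral_adjacent_intervals
    (a := fun j : ℕ => a + (2 * j - 1) * c) (n := n) (f := g) (μ := volume)
    (fun k _ => hint _ _)
  have hper := hg.intervalIntegral_add_eq 0 (a + (2 * (0 : ℕ) - 1) * c)
  have eend : a + (2 * (0 : ℕ) - 1) * c + 2 * Real.pi = a + (2 * n - 1) * c := by
    rw [← hcn]; push_cast; ring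
  rw [zero_add, eend] at hper
  rw [hper, ← hsum]
  simp only [hpiece]
  rw [Finset.sum_const, Finset.card_range, nsmul_eq_mul]
  ring

/-! ### The measure of the long chords -/

lemma longChord_bound {n : ℕ} {r θ s φ p : ℝ} (hr : 0 < r) (h : LongChord n r θ s φ p) :
    |p| ≤ r := by
  obtain ⟨t₁, t₂, -, h1, -⟩ := h
  exact (pt_bounds hr h1).1

/-- The measure of the set of lines with chords longer than `s`. -/
def longMeasure (n : ℕ) (r θ s : ℝ) : ℝ :=
  (volume {q : ℝ × ℝ | (0 ≤ q.1 ∧ 0 ≤ q.2 ∧ q.2 < 2 * Real.pi) ∧ LongChord n r θ s q.2 q.1}).toReal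

/-- Write w(φ) for the measure of the positions p ≥ 0. Then w(φ) + w(φ+π) is the full interval
length, and both summands have the same integral over a period. The countable set `S` is for the
directions where the formula for the extreme switches. -/
lemma longMeasure_eq {n : ℕ} (hn : n ≠ 0) {r : ℝ} (hr : 0 < r) (θ s : ℝ) (k : ℕ) {E : ℝ → ℝ}
    {S : Set ℝ} (hS : S.Countable)
    (hE : IntervalIntegrable E volume 0 (Real.pi / n))
    (h1 : ∀ j : ℤ, ∀ ψ ∈ Set.Ioo 0 (Real.pi / n), ψ ∉ S →
      Regular n r θ s (θ + Real.pi / n + (2 * j + k) * (Real.pi / n) + ψ) (E ψ))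
    (h2 : ∀ j : ℤ, ∀ ψ ∈ Set.Ioo 0 (Real.pi / n), ψ ∉ S →
      Regular n r θ s (θ + Real.pi / n + (2 * j + k) * (Real.pi / n) - ψ) (E ψ)) :
    longMeasure n r θ s = 2 * n * ∫ ψ in (0)..(Real.pi / n), E ψ := by
  have hnpos : (0 : ℝ) < n := by exact_mod_cast Nat.pos_of_ne_zero hn
  have hc0 : 0 < Real.pi / n := div_pos Real.pi_pos hnpos
  have hcn : Real.pi / n * n = Real.pi := by field_simp
  obtain ⟨-, hint, hvol⟩ := volume_lines (measurableSet_longChord n r θ s) (R := r)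
    (fun q hq => longChord_bound hr hq)
  set w : ℝ → ℝ := fun φ => (volume {p : ℝ | 0 ≤ p ∧
    (p, φ) ∈ {q : ℝ × ℝ | LongChord n r θ s q.2 q.1}}).toReal with hw
  have hvol' : longMeasure n r θ s = ∫ φ in (0)..(2 * Real.pi), w φ := hvol
  have hwper : Function.Periodic w (2 * Real.pi) := by
    intro φ
    simp only [hw, Set.mem_ofPred_eq, LongChord, pt_add_two_pi]
  have hwpi : ∀ φ, w φ + w (φ + Real.pi) = (volume {p | LongChord n r θ s φ p}).toReal := by
    intro φ
    have hm : MeasurableSet {p : ℝ | LongChord n r θ s φ p} :=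
      (measurableSet_longChord n r θ s).preimage (f := fun p : ℝ => (p, φ)) (by fun_prop)
    have hfin : volume {p : ℝ | LongChord n r θ s φ p} ≠ ⊤ :=
      ((measure_mono (t := Set.Icc (-r) r) fun p hp => abs_le.1 (longChord_bound hr hp)).trans_lt
        (by simp)).ne
    have e1 : volume {p : ℝ | 0 ≤ p ∧ LongChord n r θ s (φ + Real.pi) p} =
        volume ({p | LongChord n r θ s φ p} \ Set.Ici 0) := by
      have : {p : ℝ | 0 ≤ p ∧ LongChord n r θ s (φ + Real.pi) p} =
          -({p : ℝ | LongChord n r θ s φ p} ∩ Set.Iic 0) := by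
        ext p
        simp only [Set.mem_ofPred_eq, longChord_add_pi, Set.mem_neg, Set.mem_inter_iff, Set.mem_Iic]
        constructor <;> rintro ⟨h, h'⟩ <;> constructor <;> first | assumption | linarith
      rw [this, Measure.measure_neg]
      apply measure_congr
      have h0 : ∀ᵐ p : ℝ, p ≠ 0 := by
        simp [ae_iff, measure_singleton]
      filter_upwards [h0] with p hp
      apply propext
      change (_ ∧ p ≤ 0) ↔ (_ ∧ ¬ (0 ≤ p))
      rw [not_le, lt_iff_le_and_ne]
      tauto
    have e2 : {p : ℝ | 0 ≤ p ∧ LongChord n r θ s φ p} =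
        {p | LongChord n r θ s φ p} ∩ Set.Ici 0 := by
      ext p; exact and_comm
    simp only [hw, Set.mem_ofPred_eq]
    rw [e1, e2, ← ENNReal.toReal_add (measure_ne_top_of_subset Set.inter_subset_left hfin)
      (measure_ne_top_of_subset Set.sdiff_subset hfin), measure_inter_add_sdiff _ measurableSet_Ici]
  have hint' : ∀ a b, IntervalIntegrable (fun φ => w (φ + Real.pi)) volume a b := by
    intro a b
    have := (hint (a + Real.pi) (b + Real.pi)).comp_add_right Real.pi
    simpa using this
  have hshift : ∫ φ in (0)..(2 * Real.pi), w (φ + Real.pi) = ∫ φ in (0)..(2 * Real.pi), w φ := by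
    rw [intervalIntegral.integral_comp_add_right]
    have := hwper.intervalIntegral_add_eq (0 + Real.pi) 0
    rw [zero_add, zero_add] at this
    rw [zero_add, ← this, add_comm]
  have hE' : IntervalIntegrable (fun ψ => E (Real.pi / n - ψ)) volume 0 (Real.pi / n) := by
    have := hE.comp_sub_left (Real.pi / n)
    simpa using this.symm
  have hrefl : ∫ ψ in (0)..(Real.pi / n), E (Real.pi / n - ψ) = ∫ ψ in (0)..(Real.pi / n), E ψ := by
    rw [intervalIntegral.integral_comp_sub_left]; simp
  set c := Real.pi / n
  -- A half turn is n steps of size c, while the axes are 2c apart: for even n it maps axes to axes,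
  -- for odd n it lands midway between axes and exchanges ψ with c - ψ. The integral is the same
  -- either way.
  set E' : ℝ → ℝ := if Even n then E else fun ψ => E (c - ψ) with hEdef
  have hEint : IntervalIntegrable E' volume 0 c ∧ ∫ ψ in (0)..c, E' ψ = ∫ ψ in (0)..c, E ψ := by
    rw [hEdef]; split_ifs
    · exact ⟨hE, rfl⟩
    · exact ⟨hE', hrefl⟩
  set S' : Set ℝ := S ∪ (fun x => c - x) '' S
  have hS' : S'.Countable := hS.union (hS.image _)
  have hmem : ∀ ψ ∈ Set.Ioo 0 c, ψ ∉ S' → ψ ∉ S ∧ c - ψ ∈ Set.Ioo 0 c ∧ c - ψ ∉ S := by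
    intro ψ hψ h
    refine ⟨fun hx => h (Or.inl hx), ⟨by linarith [hψ.2], by linarith [hψ.1]⟩,
      fun hx => h (Or.inr ⟨_, hx, by simp⟩)⟩
  have k1 : ∀ j : ℤ, ∀ ψ ∈ Set.Ioo 0 c, ψ ∉ S' →
      Regular n r θ s (θ + c + (2 * j + k) * c + ψ + Real.pi) (E' ψ) := by
    intro j ψ hψ hψS
    obtain ⟨q1, q2, q3⟩ := hmem ψ hψ hψS
    rw [hEdef]; split_ifs with hpar
    · obtain ⟨m, hm⟩ := hpar
      have := h1 (j + m) ψ hψ q1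
      convert this using 1
      rw [← hcn, hm]; push_cast; ring
    · obtain ⟨m, hm⟩ := Nat.not_even_iff_odd.1 hpar
      have := h2 (j + m + 1) (c - ψ) q2 q3
      convert this using 1
      rw [← hcn, hm]; push_cast; ring
  have k2 : ∀ j : ℤ, ∀ ψ ∈ Set.Ioo 0 c, ψ ∉ S' →
      Regular n r θ s (θ + c + (2 * j + k) * c - ψ + Real.pi) (E' ψ) := by
    intro j ψ hψ hψS
    obtain ⟨q1, q2, q3⟩ := hmem ψ hψ hψS
    rw [hEdef]; split_ifs with hpar
    · obtain ⟨m, hm⟩ := hpar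
      have := h2 (j + m) ψ hψ q1
      convert this using 1
      rw [← hcn, hm]; push_cast; ring
    · obtain ⟨m, hm⟩ := Nat.not_even_iff_odd.1 hpar
      have := h1 (j + m) (c - ψ) q2 q3
      convert this using 1
      rw [← hcn, hm]; push_cast; ring
  have hmain := integral_two_pi_eq hn (g := fun φ => w φ + w (φ + Real.pi))
    (G := fun ψ => E ψ + E' ψ) (fun φ => by
      have e : φ + 2 * Real.pi + Real.pi = φ + Real.pi + 2 * Real.pi := by ring
      simp only [e, hwper _])
    (fun a b => (hint a b).add (hint' a b)) (θ + c + k * c) hS'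
    (fun j ψ hψ hψS => by
      have e : θ + c + k * c + 2 * j * c + ψ = θ + c + (2 * j + k) * c + ψ := by ring
      rw [hwpi, e]
      exact volume_longChord (h1 j ψ hψ (hmem ψ hψ hψS).1) (k1 j ψ hψ hψS))
    (fun j ψ hψ hψS => by
      have e : θ + c + k * c + 2 * j * c - ψ = θ + c + (2 * j + k) * c - ψ := by ring
      rw [hwpi, e]
      exact volume_longChord (h2 j ψ hψ (hmem ψ hψ hψS).1) (k2 j ψ hψ hψS))
  rw [intervalIntegral.integral_add (hint _ _) (hint' _ _), hshift,
    intervalIntegral.integral_add hE hEint.1, hEint.2] at hmain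
  rw [hvol']
  linarith

/-- The measure of all lines meeting the polygon. -/
lemma volume_nonempty {n : ℕ} (hn : 3 ≤ n) {r : ℝ} (hr : 0 < r) (θ : ℝ) :
    (volume {q : ℝ × ℝ | (0 ≤ q.1 ∧ 0 ≤ q.2 ∧ q.2 < 2 * Real.pi) ∧
      ∃ t, pt q.1 q.2 t ∈ polygon n r θ}).toReal = 2 * n * (r * Real.sin (Real.pi / n)) := by
  have hn0 : n ≠ 0 := by omega
  have hnpos : (0 : ℝ) < n := by exact_mod_cast Nat.pos_of_ne_zero hn0
  have hc0 : 0 < Real.pi / n := div_pos Real.pi_pos hnpos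
  have hcn : Real.pi / n * n = Real.pi := by field_simp
  have hc2 : Real.pi / n < Real.pi / 2 := by
    apply div_lt_div_of_pos_left Real.pi_pos (by norm_num)
    exact_mod_cast (by omega : 2 < n)
  obtain ⟨-, hint, hvol⟩ := volume_lines (measurableSet_nonempty n r θ) (R := r)
    (fun q ⟨t, ht⟩ => (pt_bounds hr ht).1)
  have hnear : ∀ φ : ℝ, ∃ (j : ℤ) (ψ : ℝ), φ = θ + 2 * (Real.pi / n) * j + ψ ∧ |ψ| ≤ Real.pi / n := by
    intro φ
    refine ⟨round ((φ - θ) / (2 * (Real.pi / n))), _, (add_sub_cancel _ _).symm, ?_⟩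
    have h := abs_sub_round ((φ - θ) / (2 * (Real.pi / n)))
    have e : φ - (θ + 2 * (Real.pi / n) * round ((φ - θ) / (2 * (Real.pi / n)))) =
        2 * (Real.pi / n) * ((φ - θ) / (2 * (Real.pi / n)) - round ((φ - θ) / (2 * (Real.pi / n)))) := by
      field_simp; ring
    rw [e, abs_mul, abs_of_pos (by positivity : 0 < 2 * (Real.pi / n))]
    nlinarith
  set c := Real.pi / n
  have hfoot : ∀ (j : ℤ) (ψ : ℝ), ∃ t, pt (r * Real.cos ψ) (θ + 2 * c * j + ψ) t ∈ polygon n r θ := by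
    intro j ψ
    have h := vertex_mem hn0 r θ j
    rw [pt_rotate _ _ _ ψ] at h
    simp only [zero_mul, add_zero] at h
    exact ⟨_, h⟩
  have hsec : ∀ (j : ℤ) (ψ : ℝ), |ψ| ≤ c →
      (volume {p : ℝ | 0 ≤ p ∧ (p, θ + 2 * c * j + ψ) ∈
        {q : ℝ × ℝ | ∃ t, pt q.1 q.2 t ∈ polygon n r θ}}).toReal = r * Real.cos ψ := by
    intro j ψ hψ
    have hcos : 0 ≤ Real.cos ψ := by
      rw [abs_le] at hψ
      exact Real.cos_nonneg_of_neg_pi_div_two_le_of_le (by linarith) (by linarith)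
    have : {p : ℝ | 0 ≤ p ∧ (p, θ + 2 * c * j + ψ) ∈
        {q : ℝ × ℝ | ∃ t, pt q.1 q.2 t ∈ polygon n r θ}} = Set.Icc 0 (r * Real.cos ψ) := by
      ext p
      simp only [Set.mem_ofPred_eq, Set.mem_Icc, and_congr_right_iff]
      intro hp
      constructor
      · rintro ⟨t, ht⟩
        have : proj (θ + 2 * c * j + ψ) (pt p (θ + 2 * c * j + ψ) t) ≤ _ :=
          proj_le_vertex hn0 hr θ j hψ ht
        rw [proj_pt] at this
        simpa using this
      · intro hp'
        obtain ⟨t, ht⟩ := hfoot j ψ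
        -- A vertex extreme in the opposite direction gives a point at signed distance -r cos ψ' ≤
        -- 0; combining it with the vertex at r cos ψ reaches every p between.
        obtain ⟨j', ψ', hφ, hψ'⟩ := hnear (θ + 2 * c * j + ψ + Real.pi)
        obtain ⟨t', ht'⟩ := hfoot j' ψ'
        rw [← hφ, pt_add_pi] at ht'
        have hcos' : 0 ≤ Real.cos ψ' := by
          rw [abs_le] at hψ'
          exact Real.cos_nonneg_of_neg_pi_div_two_le_of_le (by linarith) (by linarith)
        rcases hp.eq_or_lt with rfl | hp0
        · rcases eq_or_lt_of_le (add_nonneg (mul_nonneg hr.le hcos) (mul_nonneg hr.le hcos')) with h0 | h0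
          · have : r * Real.cos ψ = 0 := by
              have := mul_nonneg hr.le hcos; have := mul_nonneg hr.le hcos'; linarith
            exact ⟨t, by rw [← this]; exact ht⟩
          · have := convex_polygon n r θ ht ht'
              (a := r * Real.cos ψ' / (r * Real.cos ψ + r * Real.cos ψ'))
              (b := r * Real.cos ψ / (r * Real.cos ψ + r * Real.cos ψ'))
              (by positivity) (by positivity) (by rw [← add_div, add_comm, div_self h0.ne'])
            rw [pt_combo] at this
            have e : r * Real.cos ψ' / (r * Real.cos ψ + r * Real.cos ψ') * (r * Real.cos ψ) +
              r * Real.cos ψ / (r * Real.cos ψ + r * Real.cos ψ') * -(r * Real.cos ψ') = 0 := by ring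
            rw [e] at this
            exact ⟨_, this⟩
        · have h0 : 0 < r * Real.cos ψ + r * Real.cos ψ' := by
            have := mul_nonneg hr.le hcos'; linarith
          have := convex_polygon n r θ ht ht'
            (a := (p + r * Real.cos ψ') / (r * Real.cos ψ + r * Real.cos ψ'))
            (b := (r * Real.cos ψ - p) / (r * Real.cos ψ + r * Real.cos ψ'))
            (by positivity) (div_nonneg (by linarith) h0.le)
            (by rw [← add_div, div_eq_one_iff_eq h0.ne']; ring)
          rw [pt_combo] at this
          have e : (p + r * Real.cos ψ') / (r * Real.cos ψ + r * Real.cos ψ') * (r * Real.cos ψ) +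
            (r * Real.cos ψ - p) / (r * Real.cos ψ + r * Real.cos ψ') * -(r * Real.cos ψ') = p := by
            rw [div_mul_eq_mul_div, div_mul_eq_mul_div, ← add_div, div_eq_iff h0.ne']; ring
          rw [e] at this
          exact ⟨_, this⟩
    rw [this, Real.volume_Icc, sub_zero, ENNReal.toReal_ofReal (mul_nonneg hr.le hcos)]
  refine hvol.trans ?_
  rw [integral_two_pi_eq hn0 (G := fun ψ => r * Real.cos ψ) ?_ hint θ Set.countable_empty ?_ ?_]
  · rw [intervalIntegral.integral_const_mul, integral_cos, Real.sin_zero, sub_zero]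
  · intro φ
    simp only [Set.mem_ofPred_eq, pt_add_two_pi]
  · intro j ψ hψ _
    have e : θ + 2 * j * (Real.pi / n) + ψ = θ + 2 * c * j + ψ := by ring
    rw [e]
    exact hsec j ψ (abs_le.2 ⟨by linarith [hψ.1], hψ.2.le⟩)
  · intro j ψ hψ _
    have e : θ + 2 * j * (Real.pi / n) - ψ = θ + 2 * c * j + -ψ := by ring
    rw [e, hsec j (-ψ) (abs_le.2 ⟨by linarith [hψ.2], by linarith [hψ.1]⟩), Real.cos_neg]

/-! ### The distribution function in terms of the long chords -/

lemma perimeter_eq {n : ℕ} (hn : 3 ≤ n) {r : ℝ} (hr : 0 < r) (θ : ℝ) :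
    perimeter n r θ = 2 * n * (r * Real.sin (Real.pi / n)) := by
  have hnpos : (0 : ℝ) < n := by exact_mod_cast (by omega : 0 < n)
  have hc0 : 0 < Real.pi / n := div_pos Real.pi_pos hnpos
  have hcpi : Real.pi / n ≤ Real.pi :=
    div_le_self Real.pi_pos.le (by exact_mod_cast (by omega : 1 ≤ n))
  have hsin := Real.sin_nonneg_of_nonneg_of_le_pi hc0.le hcpi
  have h : ∀ i ∈ Finset.range n, dist (vertex n r θ i) (vertex n r θ (i + 1)) =
      2 * (r * Real.sin (Real.pi / n)) := by
    intro i _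
    rw [vertex_eq_pt, vertex_eq_pt, pt_rotate _ _ _ (Real.pi / n),
      pt_rotate r (θ + 2 * (Real.pi / n) * (i + 1 : ℕ)) 0 (-(Real.pi / n))]
    have e : θ + 2 * (Real.pi / n) * (i + 1 : ℕ) + -(Real.pi / n) =
      θ + 2 * (Real.pi / n) * i + Real.pi / n := by push_cast; ring
    rw [e]
    simp only [Real.cos_neg, Real.sin_neg, zero_mul, add_zero]
    rw [(isometry_pt _ _).dist_eq, Real.dist_eq]
    rw [abs_of_nonpos] <;> nlinarith
  rw [perimeter, Finset.sum_congr rfl h, Finset.sum_const, Finset.card_range, nsmul_eq_mul]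
  ring

lemma perimeter_pos {n : ℕ} (hn : 3 ≤ n) {r : ℝ} (hr : 0 < r) (θ : ℝ) : 0 < perimeter n r θ := by
  have hnpos : (0 : ℝ) < n := by exact_mod_cast (by omega : 0 < n)
  have hc0 : 0 < Real.pi / n := div_pos Real.pi_pos hnpos
  have hsin := Real.sin_pos_of_pos_of_lt_pi hc0
    (div_lt_self Real.pi_pos (by exact_mod_cast (by omega : 1 < n)))
  rw [perimeter_eq hn hr]
  positivity

/-- The lines that meet the polygon have measure equal to the perimeter, so passing to the
complement, the long chords, costs exactly 1. -/
lemma F_eq {n : ℕ} (hn : 3 ≤ n) {r : ℝ} (hr : 0 < r) (θ : ℝ) {s : ℝ} (hs : 0 ≤ s) :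
    F n r θ s = 1 - longMeasure n r θ s / (2 * n * (r * Real.sin (Real.pi / n))) := by
  have hu := perimeter_pos hn hr θ
  have hA := (volume_lines (measurableSet_nonempty n r θ) (R := r)
    (fun q ⟨t, ht⟩ => (pt_bounds hr ht).1)).1
  have hB := (volume_lines (measurableSet_longChord n r θ s) (R := r)
    (fun q hq => longChord_bound hr hq)).1
  have hV := volume_nonempty hn hr θ
  set A := {q : ℝ × ℝ | (0 ≤ q.1 ∧ 0 ≤ q.2 ∧ q.2 < 2 * Real.pi) ∧
    ∃ t, pt q.1 q.2 t ∈ polygon n r θ} with hAdef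
  set B := {q : ℝ × ℝ | (0 ≤ q.1 ∧ 0 ≤ q.2 ∧ q.2 < 2 * Real.pi) ∧ LongChord n r θ s q.2 q.1} with hBdef
  have hBm : MeasurableSet B :=
    ((measurableSet_le measurable_const measurable_fst).inter
      ((measurableSet_le measurable_const measurable_snd).inter
        (measurableSet_lt measurable_snd measurable_const))).inter (measurableSet_longChord n r θ s)
  have hBA : B ⊆ A := fun q ⟨h, t₁, _, _, h1, _⟩ => ⟨h, t₁, h1⟩
  have hset : {q : ℝ × ℝ | 0 ≤ q.1 ∧ 0 ≤ q.2 ∧ q.2 < 2 * Real.pi ∧ line q.1 q.2 ∈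
      {g | (g ∩ polygon n r θ).Nonempty ∧ chordLength n r θ g ≤ s}} = A \ B := by
    ext q
    have hne : (line q.1 q.2 ∩ polygon n r θ).Nonempty ↔ ∃ t, pt q.1 q.2 t ∈ polygon n r θ := by
      rw [line_eq_range]
      constructor
      · rintro ⟨_, ⟨t, rfl⟩, h⟩; exact ⟨t, h⟩
      · rintro ⟨t, h⟩; exact ⟨_, ⟨t, rfl⟩, h⟩
    simp only [hAdef, hBdef, Set.mem_ofPred_eq, Set.mem_sdiff, hne, chordLength_le_iff hr hs]
    tauto
  rw [F, lineMeasure, hset, measure_sdiff hBA hBm.nullMeasurableSet hB,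
    ENNReal.toReal_sub_of_le (measure_mono hBA) hA, hV, ← perimeter_eq hn hr θ]
  change _ = 1 - (volume B).toReal / _
  field_simp

lemma F_of_neg {n : ℕ} (r θ : ℝ) {s : ℝ} (hs : s < 0) : F n r θ s = 0 := by
  have : {q : ℝ × ℝ | 0 ≤ q.1 ∧ 0 ≤ q.2 ∧ q.2 < 2 * Real.pi ∧ line q.1 q.2 ∈
      {g | (g ∩ polygon n r θ).Nonempty ∧ chordLength n r θ g ≤ s}} = ∅ := by
    ext q
    simp only [Set.mem_ofPred_eq, Set.mem_empty_iff_false, iff_false]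
    rintro ⟨-, -, -, -, h⟩
    exact absurd (h.trans_lt hs) (not_lt.2 measureReal_nonneg)
  rw [F, lineMeasure, this]
  simp

lemma longMeasure_anti {n : ℕ} {r θ s s' : ℝ} (hr : 0 < r) (h : s ≤ s') :
    longMeasure n r θ s' ≤ longMeasure n r θ s := by
  have hB := (volume_lines (measurableSet_longChord n r θ s) (R := r)
    (fun q hq => longChord_bound hr hq)).1
  refine ENNReal.toReal_mono hB (measure_mono ?_)
  rintro q ⟨hq, t₁, t₂, ht, h'⟩
  exact ⟨hq, t₁, t₂, h.trans_lt ht, h'⟩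

lemma F_nonneg {n : ℕ} (hn : 3 ≤ n) {r : ℝ} (hr : 0 < r) (θ s : ℝ) : 0 ≤ F n r θ s :=
  mul_nonneg (one_div_nonneg.2 (perimeter_pos hn hr θ).le) ENNReal.toReal_nonneg

lemma F_mono_of_nonneg {n : ℕ} (hn : 3 ≤ n) {r : ℝ} (hr : 0 < r) (θ : ℝ) {s s' : ℝ} (hs : 0 ≤ s)
    (h : s ≤ s') : F n r θ s ≤ F n r θ s' := by
  have hu := perimeter_pos hn hr θ
  rw [perimeter_eq hn hr] at hu
  rw [F_eq hn hr θ hs, F_eq hn hr θ (hs.trans h)]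
  have := div_le_div_of_nonneg_right (longMeasure_anti (n := n) (θ := θ) hr h) hu.le
  linarith

/-! ### The diameter -/

/-- Here `K n + 1` is ⌊n/2⌋. Index gaps d and n - d give the same sine, and one of them is at most
⌊n/2⌋, where the sine is still increasing. -/
lemma abs_sin_le {n : ℕ} (hn : 3 ≤ n) {d : ℕ} (hd : d < n) :
    |Real.sin (Real.pi / n * d)| ≤ Real.sin ((K n + 1 : ℕ) * Real.pi / n) := by
  have hnpos : (0 : ℝ) < n := by exact_mod_cast (by omega : 0 < n)
  have hc0 : 0 < Real.pi / n := div_pos Real.pi_pos hnpos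
  have hcn : Real.pi / n * n = Real.pi := by field_simp
  have hK : 2 * (K n + 1) ≤ n ∧ n ≤ 2 * (K n + 1) + 1 := by unfold K; omega
  have key : ∀ e : ℕ, e ≤ K n + 1 →
      Real.sin (Real.pi / n * e) ≤ Real.sin ((K n + 1 : ℕ) * Real.pi / n) := by
    intro e he
    have h1 : (e : ℝ) ≤ (K n + 1 : ℕ) := by exact_mod_cast he
    have h2 : (2 : ℝ) * (K n + 1 : ℕ) ≤ n := by exact_mod_cast hK.1
    have h0 : (0 : ℝ) ≤ e := by positivity
    have e1 : (K n + 1 : ℕ) * Real.pi / n = Real.pi / n * (K n + 1 : ℕ) := by ring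
    rw [e1]
    generalize ((K n + 1 : ℕ) : ℝ) = k at *
    set c := Real.pi / n
    have := Real.pi_pos
    have := mul_nonneg hc0.le h0
    apply Real.sin_le_sin_of_le_of_le_pi_div_two
    · linarith
    · nlinarith
    · exact mul_le_mul_of_nonneg_left h1 hc0.le
  have h0 : (0 : ℝ) ≤ d := by positivity
  have h1 : (d : ℝ) ≤ n := by exact_mod_cast hd.le
  rw [abs_of_nonneg (Real.sin_nonneg_of_nonneg_of_le_pi (by positivity)
    (by nlinarith : Real.pi / n * d ≤ Real.pi))]
  by_cases h : d ≤ K n + 1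
  · exact key d h
  · have := key (n - d) (by omega)
    rw [Nat.cast_sub hd.le, mul_sub, hcn, Real.sin_pi_sub] at this
    exact this

lemma dist_vertex_le {n : ℕ} (hn : 3 ≤ n) {r : ℝ} (hr : 0 < r) (θ : ℝ) {i j : ℕ}
    (hij : i ≤ j) (hj : j < n) :
    dist (vertex n r θ i) (vertex n r θ j) ≤ ell n r (K n + 1) := by
  have key := abs_sin_le hn (d := j - i) (by omega)
  rw [Nat.cast_sub hij] at key
  rw [vertex_eq_pt, vertex_eq_pt, pt_rotate _ _ _ (Real.pi / n * (j - i)),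
    pt_rotate r (θ + 2 * (Real.pi / n) * j) 0 (-(Real.pi / n * (j - i)))]
  have e : θ + 2 * (Real.pi / n) * j + -(Real.pi / n * (j - i)) =
    θ + 2 * (Real.pi / n) * i + Real.pi / n * (j - i) := by ring
  rw [e]
  simp only [Real.cos_neg, Real.sin_neg, zero_mul, add_zero]
  rw [(isometry_pt _ _).dist_eq, Real.dist_eq]
  have e2 : 0 - r * Real.sin (Real.pi / n * (j - i)) - (0 - r * -Real.sin (Real.pi / n * (j - i))) =
    -(2 * r * Real.sin (Real.pi / n * (j - i))) := by ring
  rw [e2, abs_neg, abs_mul, abs_of_pos (by positivity), ell]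
  gcongr

lemma dist_le_ell {n : ℕ} (hn : 3 ≤ n) {r : ℝ} (hr : 0 < r) (θ : ℝ) {x y : Plane}
    (hx : x ∈ polygon n r θ) (hy : y ∈ polygon n r θ) : dist x y ≤ ell n r (K n + 1) := by
  obtain ⟨_, ⟨i, rfl⟩, _, ⟨j, rfl⟩, h⟩ := convexHull_exists_dist_ge2 hx hy
  refine h.trans ?_
  rcases le_total (i : ℕ) j with hij | hij
  · exact dist_vertex_le hn hr θ hij j.2
  · simp only [dist_comm (vertex n r θ i)]
    exact dist_vertex_le hn hr θ hij i.2

lemma F_of_ell_le {n : ℕ} (hn : 3 ≤ n) {r : ℝ} (hr : 0 < r) (θ : ℝ) {s : ℝ}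
    (hs : ell n r (K n + 1) ≤ s) : F n r θ s = 1 := by
  have hlong : ∀ φ p, ¬ LongChord n r θ s φ p := by
    rintro φ p ⟨t₁, t₂, h, h1, h2⟩
    have := dist_le_ell hn hr θ h2 h1
    rw [(isometry_pt p φ).dist_eq, Real.dist_eq] at this
    have := le_abs_self (t₂ - t₁)
    linarith
  have hs0 : 0 ≤ s := by
    have hv := vertex_mem (by omega : n ≠ 0) r θ 0
    exact (dist_nonneg.trans (dist_le_ell hn hr θ hv hv)).trans hs
  rw [F_eq hn hr θ hs0, longMeasure]
  simp [hlong]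


/-! ### The primitive of the chord distance -/

/-- The primitive of `chordDist ρ β s` that vanishes at `0`. -/
def chordDistPrim (ρ β s ψ : ℝ) : ℝ :=
  (2 * ρ * Real.sin β * Real.sin ψ
    - s * (Real.sin (2 * ψ) / 2 - ψ * Real.cos (2 * β)) / 2) / Real.sin (2 * β)

lemma chordDistPrim_zero (ρ β s : ℝ) : chordDistPrim ρ β s 0 = 0 := by simp [chordDistPrim]

lemma chordDistPrim_neg (ρ β s ψ : ℝ) : chordDistPrim ρ β s (-ψ) = -chordDistPrim ρ β s ψ := by
  simp only [chordDistPrim, Real.sin_neg, mul_neg]; ring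

lemma chordDist_neg (ρ β s ψ : ℝ) : chordDist ρ β s (-ψ) = chordDist ρ β s ψ := by
  simp only [chordDist, Real.cos_neg, sub_neg_eq_add, ← sub_eq_add_neg]; ring

lemma continuous_chordDist (ρ β s : ℝ) : Continuous (chordDist ρ β s) := by
  unfold chordDist; fun_prop

lemma hasDerivAt_chordDistPrim (ρ β s ψ : ℝ) :
    HasDerivAt (chordDistPrim ρ β s) (chordDist ρ β s ψ) ψ := by
  have h1 : HasDerivAt (fun x : ℝ => Real.sin (2 * x)) (Real.cos (2 * ψ) * 2) ψ := by
    have := (Real.hasDerivAt_sin (2 * ψ)).comp ψ ((hasDerivAt_id ψ).const_mul 2)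
    simpa [Function.comp_def] using this
  have h := (((Real.hasDerivAt_sin ψ).const_mul (2 * ρ * Real.sin β)).sub
    ((((h1.div_const 2).sub ((hasDerivAt_id ψ).mul_const (Real.cos (2 * β)))).const_mul s).div_const
      2)).div_const (Real.sin (2 * β))
  refine h.congr_deriv ?_
  have e : Real.sin (β - ψ) * Real.sin (β + ψ) = (Real.cos (2 * ψ) - Real.cos (2 * β)) / 2 := by
    rw [Real.cos_sub_cos]
    have e1 : (2 * ψ + 2 * β) / 2 = β + ψ := by ring
    have e2 : (2 * ψ - 2 * β) / 2 = -(β - ψ) := by ring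
    rw [e1, e2, Real.sin_neg]; ring
  rw [chordDist, mul_assoc s, e]
  ring

lemma integral_chordDist (ρ β s a b : ℝ) :
    ∫ ψ in a..b, chordDist ρ β s ψ = chordDistPrim ρ β s b - chordDistPrim ρ β s a :=
  intervalIntegral.integral_eq_sub_of_hasDerivAt (fun ψ _ => hasDerivAt_chordDistPrim ρ β s ψ)
    ((continuous_chordDist ρ β s).intervalIntegrable _ _)

lemma integral_chordDist_sub (ρ β s a b c : ℝ) :
    ∫ ψ in a..b, chordDist ρ β s (ψ - c) =
      chordDistPrim ρ β s (b - c) - chordDistPrim ρ β s (a - c) := by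
  rw [intervalIntegral.integral_comp_sub_right (chordDist ρ β s) c, integral_chordDist]

/-- This explains the four Θ terms: expanding sin(α - b) and sin(2α - 2b) at α = arcsin(a/s)
produces s, 1/s, √(s²-a²)/s and s·α. The relation w² = s² - a² for the square root w closes the
identity. -/
lemma h_eq_chordDistPrim {n : ℕ} {r : ℝ} (hr : 0 < r) {k : ℕ} (hk : k ≠ 0)
    (hc : Real.sin (Real.pi / n) ≠ 0) (h1 : Real.sin (k * (Real.pi / n)) ≠ 0)
    (h2 : Real.cos (k * (Real.pi / n)) ≠ 0) {s a : ℝ} (hs : 0 < s) (ha : 0 ≤ a) (has : a ≤ s)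
    (b : ℝ) :
    h n r k s a b = chordDistPrim (r * Real.cos (Real.pi / n)) (k * (Real.pi / n)) s
      (Real.arcsin (a / s) - b) / (r * Real.sin (Real.pi / n)) := by
  have hsin : Real.sin (Real.arcsin (a / s)) = a / s :=
    Real.sin_arcsin (by linarith [div_nonneg ha hs.le]) ((div_le_one hs).2 has)
  have hcos : Real.cos (Real.arcsin (a / s)) = Real.sqrt (s ^ 2 - a ^ 2) / s := by
    have e : 1 - (a / s) ^ 2 = (s ^ 2 - a ^ 2) / s ^ 2 := by field_simp
    rw [Real.cos_arcsin, e, Real.sqrt_div' _ (sq_nonneg s), Real.sqrt_sq hs.le]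
  have hsq : Real.sqrt (s ^ 2 - a ^ 2) ^ 2 = s ^ 2 - a ^ 2 := Real.sq_sqrt (by nlinarith)
  have e1 : (k : ℝ) * Real.pi / n = k * (Real.pi / n) := by ring
  have e2 : 2 * (k : ℝ) * Real.pi / n = 2 * (k * (Real.pi / n)) := by ring
  rw [h, if_neg hk, Θ₁, Θ₂, Θ₃, Θ₄, L₁, L₂, L₃, L₄, e1, e2, chordDistPrim, csc, csc, sec, cot, cot,
    mul_sub 2, Real.sin_sub, Real.sin_sub, Real.sin_two_mul (Real.arcsin (a / s)),
    Real.cos_two_mul (Real.arcsin (a / s)), hsin, hcos]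
  generalize Real.arcsin (a / s) = α
  generalize Real.sqrt (s ^ 2 - a ^ 2) = w at *
  rw [Real.cos_two_mul b, Real.sin_two_mul b, Real.sin_two_mul (k * (Real.pi / n))]
  generalize Real.cos (2 * (k * (Real.pi / n))) = C2
  generalize Real.sin (k * (Real.pi / n)) = S at *
  generalize Real.cos (k * (Real.pi / n)) = C at *
  have hr0 := hr.ne'
  have hs0 := hs.ne'
  have hw : w ^ 2 = s ^ 2 - a ^ 2 := hsq
  field_simp
  linear_combination (-8 * Real.sin b * Real.cos b) * hw

lemma integral_ite {f g : ℝ → ℝ} {a m b : ℝ} (h1 : a ≤ m) (h2 : m ≤ b)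
    (hf : IntervalIntegrable f volume a m) (hg : IntervalIntegrable g volume m b) :
    IntervalIntegrable (fun x => if x < m then f x else g x) volume a b ∧
    ∫ x in a..b, (if x < m then f x else g x) = (∫ x in a..m, f x) + ∫ x in m..b, g x := by
  have hm : ∀ᵐ x : ℝ, x ≠ m := by simp [ae_iff, measure_singleton]
  have e1 : ∀ᵐ x : ℝ, x ∈ Set.uIoc a m → f x = if x < m then f x else g x := by
    filter_upwards [hm] with x hx hx'
    rw [Set.uIoc_of_le h1] at hx'
    rw [if_pos (lt_of_le_of_ne hx'.2 hx)]
  have e2 : ∀ᵐ x : ℝ, x ∈ Set.uIoc m b → g x = if x < m then f x else g x := by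
    filter_upwards with x hx'
    rw [Set.uIoc_of_le h2] at hx'
    rw [if_neg (not_lt.2 hx'.1.le)]
  have i1 := hf.congr_ae ((ae_restrict_iff' measurableSet_uIoc).2 e1)
  have i2 := hg.congr_ae ((ae_restrict_iff' measurableSet_uIoc).2 e2)
  refine ⟨i1.trans i2, ?_⟩
  rw [← intervalIntegral.integral_add_adjacent_intervals i1 i2,
    intervalIntegral.integral_congr_ae e1, intervalIntegral.integral_congr_ae e2]

/-! ### Chords of length `s` between two sides -/

lemma sin_le_sin_of_mem {a x : ℝ} (ha : 0 ≤ a) (h1 : a ≤ x) (h2 : x ≤ Real.pi - a) :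
    Real.sin a ≤ Real.sin x := by
  have := Real.pi_pos
  rw [← sub_nonneg, Real.sin_sub_sin]
  have := Real.sin_nonneg_of_nonneg_of_le_pi (x := (x - a) / 2) (by linarith) (by linarith)
  have := Real.cos_nonneg_of_neg_pi_div_two_le_of_le (x := (x + a) / 2) (by linarith) (by linarith)
  positivity

lemma sin_lt_sin_of_mem {a x : ℝ} (ha : 0 ≤ a) (h1 : a < x) (h2 : x < Real.pi - a) :
    Real.sin a < Real.sin x := by
  have := Real.pi_pos
  rw [← sub_pos, Real.sin_sub_sin]
  have := Real.sin_pos_of_pos_of_lt_pi (x := (x - a) / 2) (by linarith) (by linarith)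
  have := Real.cos_pos_of_mem_Ioo (x := (x + a) / 2) ⟨by linarith, by linarith⟩
  positivity

/-- The angle `arcsin (A₁ k / s)` between a chord of length `s` through a vertex and a side. -/
def vertexAngle (n : ℕ) (r : ℝ) (k : ℕ) (s : ℝ) : ℝ := Real.arcsin (A₁ n r k / s)

lemma A₁_eq (n : ℕ) (r : ℝ) (k : ℕ) : A₁ n r k =
    2 * r * Real.sin (k * (Real.pi / n)) * Real.sin (k * (Real.pi / n) + Real.pi / n) := by
  have e1 : (k : ℝ) * Real.pi / n = k * (Real.pi / n) := by ring
  have e2 : ((k : ℝ) + 1) * Real.pi / n = k * (Real.pi / n) + Real.pi / n := by ring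
  rw [A₁, e1, e2]

lemma ell_eq (n : ℕ) (r : ℝ) (k : ℕ) : ell n r k = 2 * r * Real.sin (k * (Real.pi / n)) := by
  have e1 : (k : ℝ) * Real.pi / n = k * (Real.pi / n) := by ring
  rw [ell, e1]

lemma step_mul_le {n k : ℕ} (hn : 0 < n) (hk : 2 * k ≤ n) : k * (Real.pi / n) ≤ Real.pi / 2 := by
  have hnpos : (0 : ℝ) < n := by exact_mod_cast hn
  have h : 2 * (k : ℝ) ≤ n := by exact_mod_cast hk
  rw [← mul_div_assoc, div_le_div_iff₀ hnpos (by norm_num)]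
  nlinarith [Real.pi_pos]

lemma step_mul_lt {n k : ℕ} (hn : 0 < n) (hk : 2 * k < n) : k * (Real.pi / n) < Real.pi / 2 := by
  have hnpos : (0 : ℝ) < n := by exact_mod_cast hn
  have h : 2 * (k : ℝ) < n := by exact_mod_cast hk
  rw [← mul_div_assoc, div_lt_div_iff₀ hnpos (by norm_num)]
  nlinarith [Real.pi_pos]

lemma step_pos {n : ℕ} (hn : 0 < n) : 0 < Real.pi / n :=
  div_pos Real.pi_pos (by exact_mod_cast hn)

section

variable {n : ℕ} {r : ℝ} {k : ℕ} {s : ℝ}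

/-- Since A₁(k) = ℓ_k sin((k+1)π/n) = ℓ_{k+1} sin(kπ/n), the range of s places A₁(k)/s between
sin(kπ/n) and sin((k+1)π/n). Hence the switching angle m lies in [0, π/n]. -/
lemma vertexAngle_facts (hn : 3 ≤ n) (hr : 0 < r) (hk : 2 * (k + 1) ≤ n) (hs : 0 < s)
    (h1 : ell n r k ≤ s) (h2 : s < ell n r (k + 1)) :
    0 ≤ A₁ n r k ∧ A₁ n r k ≤ s ∧ s * Real.sin (vertexAngle n r k s) = A₁ n r k ∧
      k * (Real.pi / n) ≤ vertexAngle n r k s ∧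
      vertexAngle n r k s ≤ k * (Real.pi / n) + Real.pi / n ∧
      k * (Real.pi / n) + Real.pi / n ≤ Real.pi / 2 := by
  have hc0 := step_pos (n := n) (by omega)
  have hk1 := step_mul_le (n := n) (k := k + 1) (by omega) hk
  push_cast at hk1
  rw [add_mul, one_mul] at hk1
  rw [ell_eq] at h1 h2
  push_cast at h2
  rw [add_mul, one_mul] at h2
  rw [vertexAngle, A₁_eq]
  have hk0 : 0 ≤ k * (Real.pi / n) := by positivity
  set β := k * (Real.pi / n)
  set c := Real.pi / n
  have hp := Real.pi_pos
  have hs1 : 0 ≤ Real.sin β := Real.sin_nonneg_of_nonneg_of_le_pi hk0 (by linarith)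
  have hs2 : 0 ≤ Real.sin (β + c) := Real.sin_nonneg_of_nonneg_of_le_pi (by linarith) (by linarith)
  have hA : 0 ≤ 2 * r * Real.sin β * Real.sin (β + c) := by positivity
  have hA1 : 2 * r * Real.sin β * Real.sin (β + c) ≤ s * Real.sin (β + c) := by gcongr
  have hA2 : s * Real.sin β ≤ 2 * r * Real.sin β * Real.sin (β + c) := by nlinarith
  have hAs : 2 * r * Real.sin β * Real.sin (β + c) ≤ s :=
    hA1.trans (mul_le_of_le_one_right hs.le (Real.sin_le_one _))
  refine ⟨hA, hAs, ?_, ?_, ?_, hk1⟩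
  · rw [Real.sin_arcsin (by linarith [div_nonneg hA hs.le]) ((div_le_one hs).2 hAs)]
    field_simp
  · rw [← Real.arcsin_sin (x := β) (by linarith) (by linarith)]
    apply Real.monotone_arcsin
    rw [Real.arcsin_sin (by linarith) (by linarith), le_div_iff₀ hs]; linarith
  · rw [← Real.arcsin_sin (x := β + c) (by linarith) (by linarith)]
    apply Real.monotone_arcsin
    rw [Real.arcsin_sin (by linarith) (by linarith), div_le_iff₀ hs]; linarith

/-- For sides k apart the outer endpoint bound is A₁(k) = s sin(vertexAngle), which is precisely the
restriction on ψ; the inner bound follows from s ≥ ℓ_k. -/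
lemma isUpper_small (hn : 3 ≤ n) (hr : 0 < r) (hk : 2 * (k + 1) ≤ n) (hs : 0 < s)
    (h1 : ell n r k ≤ s) (h2 : s < ell n r (k + 1)) (θ : ℝ) (j : ℤ) {ψ : ℝ}
    (hψ : |ψ| < vertexAngle n r k s - k * (Real.pi / n)) :
    IsUpper n r θ s (θ + Real.pi / n + (2 * j + k) * (Real.pi / n) + ψ)
      (chordDist (r * Real.cos (Real.pi / n)) (k * (Real.pi / n)) s ψ) := by
  obtain ⟨f1, f2, f3, f4, f5, f6⟩ := vertexAngle_facts hn hr hk hs h1 h2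
  have hc0 := step_pos (n := n) (by omega)
  have hk0 : k ≠ 0 := by
    rintro rfl
    have : vertexAngle n r 0 s = 0 := by simp [vertexAngle, A₁]
    rw [this] at hψ
    simp only [Nat.cast_zero, zero_mul, sub_zero] at hψ
    -- For k = 0 the range of ψ is empty, so the degenerate pair of equal sides never occurs.
    exact absurd (abs_nonneg ψ) (not_le.2 hψ)
  have hk1 : (1 : ℝ) ≤ k := by exact_mod_cast Nat.one_le_iff_ne_zero.2 hk0
  have hβc : Real.pi / n ≤ k * (Real.pi / n) := le_mul_of_one_le_left hc0.le hk1
  rw [ell_eq] at h1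
  rw [A₁_eq] at f3
  have hp := Real.pi_pos
  obtain ⟨q1, q2⟩ := abs_lt.1 hψ
  have hβ : 0 < Real.sin (k * (Real.pi / n)) :=
    Real.sin_pos_of_pos_of_lt_pi (by linarith) (by linarith)
  have hmono : ∀ {x y : ℝ}, 0 ≤ x → x ≤ y → y ≤ Real.pi / 2 → Real.sin x ≤ Real.sin y :=
    fun hx hxy hy => Real.sin_le_sin_of_le_of_le_pi_div_two (by linarith) hy hxy
  have hmono' : ∀ {x : ℝ}, 0 ≤ x → x < vertexAngle n r k s →
      Real.sin x < Real.sin (vertexAngle n r k s) :=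
    fun hx hxy => Real.sin_lt_sin_of_lt_of_le_pi_div_two (by linarith) (by linarith) hxy
  have hlow : 0 ≤ Real.sin (k * (Real.pi / n) - Real.pi / n) :=
    Real.sin_nonneg_of_nonneg_of_le_pi (by linarith) (by linarith)
  refine isUpper_chordDist θ j k hn hr hβ (Real.cos_pos_of_mem_Ioo ⟨by linarith, by linarith⟩)
    (Real.sin_pos_of_pos_of_lt_pi (by linarith) (by linarith))
    (Real.sin_pos_of_pos_of_lt_pi (by linarith) (by linarith)) ?_ ?_ ?_ ?_
  · exact mul_le_mul h1 (hmono (by linarith) (by linarith) (by linarith)) hlow hs.le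
  · exact mul_le_mul h1 (hmono (by linarith) (by linarith) (by linarith)) hlow hs.le
  · rw [← f3]; exact mul_lt_mul_of_pos_left (hmono' (by linarith) (by linarith)) hs
  · rw [← f3]; exact mul_lt_mul_of_pos_left (hmono' (by linarith) (by linarith)) hs

/-- For sides k+1 apart, A₁(k) becomes the inner endpoint bound and is met on the other side of the
switching angle. The outer bounds `hu1`, `hu2` stay as hypotheses because they can fail for odd n
and s ≥ λ. -/
lemma isUpper_large (hn : 3 ≤ n) (hr : 0 < r) (hk : 2 * (k + 1) < n) (hs : 0 < s)
    (h1 : ell n r k ≤ s) (h2 : s < ell n r (k + 1)) (θ : ℝ) (j : ℤ) {ψ : ℝ}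
    (hψ : |ψ| < k * (Real.pi / n) + Real.pi / n - vertexAngle n r k s)
    (hu1 : s * Real.sin ((k + 1 : ℕ) * (Real.pi / n) - ψ) < A₁ n r (k + 1))
    (hu2 : s * Real.sin ((k + 1 : ℕ) * (Real.pi / n) + ψ) < A₁ n r (k + 1)) :
    IsUpper n r θ s (θ + Real.pi / n + (2 * j + (k + 1 : ℕ)) * (Real.pi / n) + ψ)
      (chordDist (r * Real.cos (Real.pi / n)) ((k + 1 : ℕ) * (Real.pi / n)) s ψ) := by
  obtain ⟨f1, f2, f3, f4, f5, f6⟩ := vertexAngle_facts hn hr hk.le hs h1 h2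
  have hc0 := step_pos (n := n) (by omega)
  have hp := Real.pi_pos
  have hk2 := step_mul_lt (n := n) (k := k + 1) (by omega) hk
  have hkc : 0 ≤ k * (Real.pi / n) := by positivity
  have e : ((k + 1 : ℕ) : ℝ) * (Real.pi / n) = k * (Real.pi / n) + Real.pi / n := by
    push_cast; ring
  rw [A₁_eq] at hu1 hu2 f3
  obtain ⟨q1, q2⟩ := abs_lt.1 hψ
  have key : ∀ {x : ℝ}, vertexAngle n r k s ≤ x → x ≤ Real.pi - vertexAngle n r k s →
      2 * r * Real.sin ((k + 1 : ℕ) * (Real.pi / n)) *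
        Real.sin ((k + 1 : ℕ) * (Real.pi / n) - Real.pi / n) ≤ s * Real.sin x := by
    intro x hx1 hx2
    rw [e, add_sub_cancel_right]
    have := mul_le_mul_of_nonneg_left
      (sin_le_sin_of_mem (hkc.trans f4) hx1 hx2) hs.le
    linarith
  refine isUpper_chordDist θ j (k + 1) hn hr (Real.sin_pos_of_pos_of_lt_pi ?_ ?_)
    (Real.cos_pos_of_mem_Ioo ⟨?_, ?_⟩)
    (Real.sin_pos_of_pos_of_lt_pi ?_ ?_)
    (Real.sin_pos_of_pos_of_lt_pi ?_ ?_) (key ?_ ?_) (key ?_ ?_) hu1 hu2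
  all_goals rw [e]; rw [e] at hk2; linarith

end


/-! ### The extremal chord in each direction, and its integral -/

section

variable {n : ℕ} {r : ℝ} {k : ℕ} {s : ℝ}

lemma regular_small (hn : 3 ≤ n) (hr : 0 < r) (hk : 2 * (k + 1) ≤ n) (hs : 0 < s)
    (h1 : ell n r k ≤ s) (h2 : s < ell n r (k + 1)) (θ : ℝ) (j : ℤ) {ψ : ℝ} (hψ : 0 < ψ)
    (hψ' : ψ < vertexAngle n r k s - k * (Real.pi / n)) :
    Regular n r θ s (θ + Real.pi / n + (2 * j + k) * (Real.pi / n) + ψ)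
      (chordDist (r * Real.cos (Real.pi / n)) (k * (Real.pi / n)) s ψ) ∧
    Regular n r θ s (θ + Real.pi / n + (2 * j + k) * (Real.pi / n) - ψ)
      (chordDist (r * Real.cos (Real.pi / n)) (k * (Real.pi / n)) s ψ) := by
  constructor
  · exact Or.inl (isUpper_small hn hr hk hs h1 h2 θ j (by rwa [abs_of_pos hψ]))
  · have := isUpper_small hn hr hk hs h1 h2 θ j (ψ := -ψ) (by rwa [abs_neg, abs_of_pos hψ])
    rw [chordDist_neg, ← sub_eq_add_neg] at this
    exact Or.inl this

lemma regular_large (hn : 3 ≤ n) (hr : 0 < r) (hk : 2 * (k + 1) < n) (hs : 0 < s)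
    (h1 : ell n r k ≤ s) (h2 : s < ell n r (k + 1)) (θ : ℝ) (j : ℤ) {ψ : ℝ}
    (hψ : ψ < Real.pi / n) (hψ' : vertexAngle n r k s - k * (Real.pi / n) < ψ)
    (hu1 : s * Real.sin (k * (Real.pi / n) + ψ) < A₁ n r (k + 1))
    (hu2 : s * Real.sin ((k + 2) * (Real.pi / n) - ψ) < A₁ n r (k + 1)) :
    Regular n r θ s (θ + Real.pi / n + (2 * j + k) * (Real.pi / n) + ψ)
      (chordDist (r * Real.cos (Real.pi / n)) ((k + 1 : ℕ) * (Real.pi / n)) s (ψ - Real.pi / n)) ∧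
    Regular n r θ s (θ + Real.pi / n + (2 * j + k) * (Real.pi / n) - ψ)
      (chordDist (r * Real.cos (Real.pi / n)) ((k + 1 : ℕ) * (Real.pi / n)) s
        (ψ - Real.pi / n)) := by
  have e1 : ((k + 1 : ℕ) : ℝ) * (Real.pi / n) - (ψ - Real.pi / n) =
      (k + 2) * (Real.pi / n) - ψ := by push_cast; ring
  have e2 : ((k + 1 : ℕ) : ℝ) * (Real.pi / n) + (ψ - Real.pi / n) = k * (Real.pi / n) + ψ := by
    push_cast; ring
  have habs : |ψ - Real.pi / n| < k * (Real.pi / n) + Real.pi / n - vertexAngle n r k s := by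
    rw [abs_of_neg (by linarith)]; linarith
  constructor
  · have := isUpper_large hn hr hk hs h1 h2 θ j habs (by rwa [e1]) (by rwa [e2])
    refine Or.inl ?_
    convert this using 1
    push_cast; ring
  -- The direction -ψ is measured from the neighbouring axis with index 2(j-1)+(k+1), one step below
  -- 2j+k.
  · have := isUpper_large hn hr hk hs h1 h2 θ (j - 1) (ψ := -(ψ - Real.pi / n))
      (by rwa [abs_neg]) (by rwa [sub_neg_eq_add, e2]) (by rwa [← sub_eq_add_neg, e1])
    rw [chordDist_neg] at this
    refine Or.inl ?_
    convert this using 1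
    push_cast; ring

/-- For even `n`, directions in which all chords are shorter than the width between opposite
sides. -/
lemma regular_short_even (hn : 3 ≤ n) (hr : 0 < r) (hk : 2 * (k + 1) = n) (hs : 0 < s)
    (h1 : ell n r k ≤ s) (h2 : s < ell n r (k + 1)) (θ : ℝ) (j : ℤ) {ψ : ℝ}
    (hψ : ψ < Real.pi / n) (hψ' : vertexAngle n r k s - k * (Real.pi / n) < ψ) :
    Regular n r θ s (θ + Real.pi / n + (2 * j + k) * (Real.pi / n) + ψ) 0 ∧
    Regular n r θ s (θ + Real.pi / n + (2 * j + k) * (Real.pi / n) - ψ) 0 := by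
  obtain ⟨f1, f2, f3, f4, f5, f6⟩ := vertexAngle_facts hn hr hk.le hs h1 h2
  have hc0 := step_pos (n := n) (by omega)
  have hp := Real.pi_pos
  have hkc : 0 ≤ k * (Real.pi / n) := by positivity
  have hhalf : k * (Real.pi / n) + Real.pi / n = Real.pi / 2 := by
    have hne : (n : ℝ) ≠ 0 := by exact_mod_cast (by omega : n ≠ 0)
    have : (n : ℝ) = 2 * (k + 1) := by exact_mod_cast hk.symm
    field_simp
    linarith
  have e : ((k + 1 : ℕ) : ℝ) * (Real.pi / n) = Real.pi / 2 := by rw [← hhalf]; push_cast; ring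
  have e' : k * (Real.pi / n) = Real.pi / 2 - Real.pi / n := by linarith
  rw [A₁_eq, hhalf, e', Real.sin_pi_div_two_sub, Real.sin_pi_div_two, mul_one] at f3
  -- Sides k+1 = n/2 apart are parallel, β = π/2, and `chord_ineq` reduces to the strip bound s cos
  -- χ ≤ 2r cos(π/n). The right side equals s sin(vertexAngle), which is smaller than s cos χ here.
  have key : ∀ (i : ℤ) (χ : ℝ), |χ| < Real.pi / 2 - vertexAngle n r k s → ∀ p,
      ¬ ChordAt n r θ s (θ + Real.pi / n + (2 * i + (k + 1 : ℕ)) * (Real.pi / n) + χ) p := by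
    intro i χ hχ p hchord
    obtain ⟨q1, q2⟩ := abs_lt.1 hχ
    have hcos : 0 < Real.cos χ := Real.cos_pos_of_mem_Ioo ⟨by linarith, by linarith⟩
    have hlt : Real.sin (vertexAngle n r k s) < Real.cos χ := by
      rw [← Real.sin_pi_div_two_sub]
      exact sin_lt_sin_of_mem (by linarith) (by linarith) (by linarith)
    have := chord_ineq θ i (k + 1) (by omega) hr
      (by rw [e, Real.sin_pi_div_two_sub]; exact hcos.le)
      (by rw [e, add_comm, Real.sin_add_pi_div_two]; exact hcos.le) hchord
    rw [e, Real.sin_pi_div_two_sub, add_comm (Real.pi / 2) χ, Real.sin_add_pi_div_two,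
      mul_div_cancel₀ _ (two_ne_zero), Real.sin_pi, Real.sin_pi_div_two] at this
    have h3 : s * Real.cos χ ≤ 2 * (r * Real.cos (Real.pi / n)) := by
      refine le_of_mul_le_mul_right ?_ hcos; linarith
    have h4 := mul_lt_mul_of_pos_left hlt hs
    linarith
  constructor
  · refine Or.inr ⟨fun p hp => key j (ψ - Real.pi / n) ?_ p ?_, rfl⟩
    · rw [abs_of_neg (by linarith)]; linarith
    · convert hp using 1; push_cast; ring
  · refine Or.inr ⟨fun p hp => key (j - 1) (Real.pi / n - ψ) ?_ p ?_, rfl⟩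
    · rw [abs_of_pos (by linarith)]; linarith
    · convert hp using 1; push_cast; ring

/-- Directions in which all chords are short because of the width orthogonal to a side. -/
lemma regular_short_of_width (hn : n ≠ 0) (hr : 0 < r) (θ : ℝ) (j : ℤ) {ψ : ℝ}
    (h0 : 0 ≤ Real.sin ((k + 2) * (Real.pi / n) - ψ))
    (h : r * Real.cos (Real.pi / n) + r < s * Real.sin ((k + 2) * (Real.pi / n) - ψ)) :
    Regular n r θ s (θ + Real.pi / n + (2 * j + k) * (Real.pi / n) + ψ) 0 ∧
    Regular n r θ s (θ + Real.pi / n + (2 * j + k) * (Real.pi / n) - ψ) 0 := by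
  constructor
  · refine Or.inr ⟨fun p hp => not_lt.2 (chordAt_mul_sin_le θ (j + k + 1) hn hr h0 ?_ hp) h, rfl⟩
    left; push_cast; ring
  · refine Or.inr ⟨fun p hp => not_lt.2 (chordAt_mul_sin_le θ (j - 1) hn hr h0 ?_ hp) h, rfl⟩
    right; push_cast; ring

/-! ### The distribution function on `[ell k, ell (k + 1))` -/

lemma F_eq_integral (hn : 3 ≤ n) (hr : 0 < r) (θ : ℝ) (hs : 0 < s) {E : ℝ → ℝ}
    {S : Set ℝ} (hS : S.Countable) (hE : IntervalIntegrable E volume 0 (Real.pi / n))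
    (h : ∀ j : ℤ, ∀ ψ ∈ Set.Ioo 0 (Real.pi / n), ψ ∉ S →
      Regular n r θ s (θ + Real.pi / n + (2 * j + k) * (Real.pi / n) + ψ) (E ψ) ∧
      Regular n r θ s (θ + Real.pi / n + (2 * j + k) * (Real.pi / n) - ψ) (E ψ)) :
    F n r θ s = 1 - (∫ ψ in (0)..(Real.pi / n), E ψ) / (r * Real.sin (Real.pi / n)) := by
  have hnpos : (0 : ℝ) < n := by exact_mod_cast (by omega : 0 < n)
  have hsin := Real.sin_pos_of_pos_of_lt_pi (step_pos (n := n) (by omega))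
    (div_lt_self Real.pi_pos (by exact_mod_cast (by omega : 1 < n)))
  rw [F_eq hn hr θ hs.le, longMeasure_eq (by omega) hr θ s k hS hE
    (fun j ψ hψ hψS => (h j ψ hψ hψS).1) (fun j ψ hψ hψS => (h j ψ hψ hψS).2)]
  field_simp

lemma h_small_eq (hn : 3 ≤ n) (hr : 0 < r) (hk : 2 * (k + 1) ≤ n) (hs : 0 < s)
    (h1 : ell n r k ≤ s) (h2 : s < ell n r (k + 1)) :
    h n r k s (A₁ n r k) (B₁ n k) =
      chordDistPrim (r * Real.cos (Real.pi / n)) (k * (Real.pi / n)) s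
        (vertexAngle n r k s - k * (Real.pi / n)) / (r * Real.sin (Real.pi / n)) := by
  obtain ⟨f1, f2, f3, f4, f5, f6⟩ := vertexAngle_facts hn hr hk hs h1 h2
  have hc0 := step_pos (n := n) (by omega)
  have hp := Real.pi_pos
  rcases Nat.eq_zero_or_pos k with rfl | hk0
  -- For k = 0 both sides vanish: `h` by convention, the primitive because its denominator sin 0
  -- makes the quotient 0.
  · simp [h, chordDistPrim]
  have hkpos : 0 < k * (Real.pi / n) := mul_pos (by exact_mod_cast hk0) hc0
  have eB : B₁ n k = k * (Real.pi / n) := by rw [B₁]; ring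
  rw [h_eq_chordDistPrim hr hk0.ne' (Real.sin_pos_of_pos_of_lt_pi hc0 (by linarith)).ne'
    (Real.sin_pos_of_pos_of_lt_pi hkpos (by linarith)).ne'
    (Real.cos_pos_of_mem_Ioo ⟨by linarith, by linarith⟩).ne' hs f1 f2, eB, vertexAngle]

lemma h_large_eq (hn : 3 ≤ n) (hr : 0 < r) (hk : 2 * (k + 1) < n) (hs : 0 < s) {a : ℝ}
    (ha : 0 ≤ a) (has : a ≤ s) (b : ℝ) :
    h n r (k + 1) s a b =
      chordDistPrim (r * Real.cos (Real.pi / n)) ((k + 1 : ℕ) * (Real.pi / n)) s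
        (Real.arcsin (a / s) - b) / (r * Real.sin (Real.pi / n)) := by
  have hc0 := step_pos (n := n) (by omega)
  have hp := Real.pi_pos
  have hlt := step_mul_lt (n := n) (k := k + 1) (by omega) hk
  have hkpos : 0 < (k + 1 : ℕ) * (Real.pi / n) := mul_pos (by positivity) hc0
  have hc : Real.pi / n < Real.pi := div_lt_self Real.pi_pos (by exact_mod_cast (by omega : 1 < n))
  exact h_eq_chordDistPrim hr (Nat.succ_ne_zero k) (Real.sin_pos_of_pos_of_lt_pi hc0 hc).ne'
    (Real.sin_pos_of_pos_of_lt_pi hkpos (by linarith)).ne'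
    (Real.cos_pos_of_mem_Ioo ⟨by linarith, by linarith⟩).ne' hs ha has b

lemma h_vertex_large_eq (hn : 3 ≤ n) (hr : 0 < r) (hk : 2 * (k + 1) < n) (hs : 0 < s)
    (h1 : ell n r k ≤ s) (h2 : s < ell n r (k + 1)) :
    h n r (k + 1) s (A₁ n r k) (B₁ n k + Real.pi / n) =
      chordDistPrim (r * Real.cos (Real.pi / n)) ((k + 1 : ℕ) * (Real.pi / n)) s
        (vertexAngle n r k s - k * (Real.pi / n) - Real.pi / n) /
          (r * Real.sin (Real.pi / n)) := by
  obtain ⟨f1, f2, -⟩ := vertexAngle_facts hn hr hk.le hs h1 h2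
  have eB : B₁ n k = k * (Real.pi / n) := by rw [B₁]; ring
  rw [h_large_eq hn hr hk hs f1 f2, eB, vertexAngle, sub_sub]

/-- All directions contain chords of length `s`. -/
lemma F_eq_of_all_long (hn : 3 ≤ n) (hr : 0 < r) (hk : 2 * (k + 1) < n) (hs : 0 < s)
    (h1 : ell n r k ≤ s) (h2 : s < ell n r (k + 1)) (θ : ℝ)
    (hu : ∀ x, k * (Real.pi / n) ≤ x → x < (k + 2) * (Real.pi / n) →
      s * Real.sin x < A₁ n r (k + 1)) :
    F n r θ s = 1 - h n r k s (A₁ n r k) (B₁ n k)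
      + h n r (k + 1) s (A₁ n r k) (B₁ n k + Real.pi / n) := by
  obtain ⟨f1, f2, f3, f4, f5, f6⟩ := vertexAngle_facts hn hr hk.le hs h1 h2
  have hc0 := step_pos (n := n) (by omega)
  rw [h_small_eq hn hr hk.le hs h1 h2, h_vertex_large_eq hn hr hk hs h1 h2]
  set ρ := r * Real.cos (Real.pi / n)
  set m := vertexAngle n r k s - k * (Real.pi / n) with hm
  obtain ⟨hE, hI⟩ := integral_ite (f := chordDist ρ (k * (Real.pi / n)) s)
    (g := fun ψ => chordDist ρ ((k + 1 : ℕ) * (Real.pi / n)) s (ψ - Real.pi / n))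
    (a := 0) (m := m) (b := Real.pi / n) (by linarith) (by linarith)
    ((continuous_chordDist _ _ _).intervalIntegrable _ _)
    (((continuous_chordDist _ _ _).comp (continuous_sub_right _)).intervalIntegrable _ _)
  rw [F_eq_integral hn hr θ hs (k := k) (S := {m}) (Set.countable_singleton m) hE, hI,
    integral_chordDist, integral_chordDist_sub, sub_self, chordDistPrim_zero, chordDistPrim_zero]
  · ring
  · intro j ψ hψ hψm
    have hψm' : ψ ≠ m := hψm
    by_cases hlt : ψ < m
    · rw [if_pos hlt]
      exact regular_small hn hr hk.le hs h1 h2 θ j hψ.1 hlt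
    · rw [if_neg hlt]
      have hgt : m < ψ := lt_of_le_of_ne (not_lt.1 hlt) hψm'.symm
      refine regular_large hn hr hk hs h1 h2 θ j hψ.2 hgt (hu _ ?_ ?_) (hu _ ?_ ?_)
      · linarith [hψ.1]
      · linarith [hψ.2]
      · linarith [hψ.2]
      · linarith [hψ.1]

lemma F_eq_even_last (hn : 3 ≤ n) (hr : 0 < r) (hk : 2 * (k + 1) = n) (hs : 0 < s)
    (h1 : ell n r k ≤ s) (h2 : s < ell n r (k + 1)) (θ : ℝ) :
    F n r θ s = 1 - h n r k s (A₁ n r k) (B₁ n k) := by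
  obtain ⟨f1, f2, f3, f4, f5, f6⟩ := vertexAngle_facts hn hr hk.le hs h1 h2
  rw [h_small_eq hn hr hk.le hs h1 h2]
  set ρ := r * Real.cos (Real.pi / n)
  set m := vertexAngle n r k s - k * (Real.pi / n) with hm
  obtain ⟨hE, hI⟩ := integral_ite (f := chordDist ρ (k * (Real.pi / n)) s)
    (g := fun _ => 0) (a := 0) (m := m) (b := Real.pi / n) (by linarith) (by linarith)
    ((continuous_chordDist _ _ _).intervalIntegrable _ _) (by simp)
  rw [F_eq_integral hn hr θ hs (k := k) (S := {m}) (Set.countable_singleton m) hE, hI,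
    integral_chordDist, chordDistPrim_zero]
  · simp
  · intro j ψ hψ hψm
    have hψm' : ψ ≠ m := hψm
    by_cases hlt : ψ < m
    · rw [if_pos hlt]
      exact regular_small hn hr hk.le hs h1 h2 θ j hψ.1 hlt
    · rw [if_neg hlt]
      exact regular_short_even hn hr hk hs h1 h2 θ j hψ.2
        (lt_of_le_of_ne (not_lt.1 hlt) hψm'.symm)

/-! ### Polygons with an odd number of sides -/

lemma odd_angle (hn : n = 2 * k + 3) :
    k * (Real.pi / n) = Real.pi / 2 - 3 * (Real.pi / n / 2) := by
  have hn' : (n : ℝ) = 2 * k + 3 := by exact_mod_cast hn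
  have : (0 : ℝ) < n := by rw [hn']; positivity
  field_simp
  rw [hn']; ring

lemma lam_eq (n : ℕ) (r : ℝ) : lam n r = 2 * r * Real.cos (Real.pi / n / 2) ^ 2 := by
  have e : Real.pi / (2 * n) = Real.pi / n / 2 := by ring
  rw [lam, e]

/-- Apothem plus circumradius: λ is the width bound appearing in `chordAt_mul_sin_le`. -/
lemma lam_eq_width (n : ℕ) (r : ℝ) : lam n r = r * Real.cos (Real.pi / n) + r := by
  have e : Real.pi / n = 2 * (Real.pi / n / 2) := by ring
  rw [lam_eq, e, Real.cos_two_mul]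
  have e' : 2 * (Real.pi / n / 2) / 2 = Real.pi / n / 2 := by ring
  rw [e']; ring

/-- The angles (k+1)π/n and (k+2)π/n are symmetric about π/2. So λ is also the outer endpoint bound
for sides k+1 apart, and the same threshold governs existence and failure of these chords. -/
lemma A₁_odd (hn : n = 2 * k + 3) (r : ℝ) : A₁ n r (k + 1) = lam n r := by
  have h := odd_angle hn
  have e1 : ((k + 1 : ℕ) : ℝ) * (Real.pi / n) = Real.pi / 2 - Real.pi / n / 2 := by
    push_cast; linarith
  have e2 : Real.pi / 2 - Real.pi / n / 2 + Real.pi / n = Real.pi / n / 2 + Real.pi / 2 := by ring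
  rw [A₁_eq, e1, e2, Real.sin_pi_div_two_sub, Real.sin_add_pi_div_two, lam_eq]
  ring

lemma ell_le_lam (hn : n = 2 * k + 3) (hr : 0 < r) : ell n r k ≤ lam n r := by
  have h := odd_angle hn
  have hc0 := step_pos (n := n) (by omega)
  have hk0 : 0 ≤ k * (Real.pi / n) := by positivity
  have hp := Real.pi_pos
  have h1 : Real.cos (3 * (Real.pi / n / 2)) ≤ Real.cos (Real.pi / n) :=
    Real.cos_le_cos_of_nonneg_of_le_pi hc0.le (by linarith) (by linarith)
  rw [ell_eq, h, Real.sin_pi_div_two_sub, lam_eq_width]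
  nlinarith [Real.cos_le_one (Real.pi / n)]

/-- Put c = π/n, α₂ = arcsin(λ/s), x = α₂ - (k+1)c. The extremal chord joins sides k apart on (0, m)
and sides k+1 apart on (m, x) and (c - x, c); on (x, c - x) the width excludes chords of length s.
The two extra h terms are the primitive at x - c and, by oddness, at x. -/
lemma F_eq_odd_last (hn : 3 ≤ n) (hr : 0 < r) (hk : n = 2 * k + 3) (hs : 0 < s)
    (h1 : ell n r k ≤ s) (h2 : s < ell n r (k + 1)) (hlam : lam n r ≤ s) (θ : ℝ) :
    F n r θ s = 1 - h n r k s (A₁ n r k) (B₁ n k)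
      + h n r (k + 1) s (A₁ n r k) (B₁ n k + Real.pi / n)
      - h n r (k + 1) s (A₂ n r) (B₂ n + Real.pi / n) - h n r (k + 1) s (A₂ n r) (B₂ n) := by
  obtain ⟨f1, f2, f3, f4, f5, f6⟩ := vertexAngle_facts hn hr (by omega : 2 * (k + 1) ≤ n) hs h1 h2
  have hc0 := step_pos (n := n) (by omega)
  have hk2 : 2 * (k + 1) < n := by omega
  have hangle := odd_angle hk
  have hp := Real.pi_pos
  have hk0 : 0 ≤ k * (Real.pi / n) := by positivity
  have hA₂ : A₂ n r = lam n r := rfl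
  have hlam0 : 0 ≤ lam n r := by rw [lam]; positivity
  have hB₂ : B₂ n = k * (Real.pi / n) + Real.pi / n := by
    rw [B₂, hangle]; ring
  rw [h_small_eq hn hr hk2.le hs h1 h2, h_vertex_large_eq hn hr hk2 hs h1 h2,
    h_large_eq hn hr hk2 hs (a := A₂ n r) hlam0 hlam, h_large_eq hn hr hk2 hs (a := A₂ n r) hlam0 hlam,
    hA₂, hB₂]
  set α₂ := Real.arcsin (lam n r / s) with hα₂
  have hdiv0 : 0 ≤ lam n r / s := by positivity
  have hα₂0 : 0 ≤ α₂ := Real.arcsin_nonneg.2 hdiv0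
  have hα₂1 : α₂ ≤ Real.pi / 2 := Real.arcsin_le_pi_div_two _
  have hsα₂ : s * Real.sin α₂ = lam n r := by
    rw [hα₂, Real.sin_arcsin (by linarith) ((div_le_one hs).2 hlam)]; field_simp
  have hle_of : ∀ x, 0 ≤ x → x ≤ Real.pi / 2 → s * Real.sin x ≤ lam n r → x ≤ α₂ := by
    intro x hx0 hx1 hx
    rw [← Real.arcsin_sin (x := x) (by linarith) hx1]
    exact Real.monotone_arcsin (by rw [le_div_iff₀ hs]; linarith)
  -- This is m ≤ x. Write α for the vertex angle. If α + c > π/2, then s cos c < s sin α = A₁(k) ≤ λ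
  -- cos c ≤ s cos c, which is absurd. Below π/2 it suffices that s sin(α + c) ≤ λ, which follows
  -- from s < ℓ_{k+1} and λ = 2r sin²((k+1)c).
  have hord : vertexAngle n r k s + Real.pi / n ≤ α₂ := by
    have hmid : vertexAngle n r k s + Real.pi / n ≤ Real.pi / 2 := by
      by_contra hc
      push Not at hc
      have hlt : Real.sin (k * (Real.pi / n) + Real.pi / n / 2) <
          Real.sin (vertexAngle n r k s) :=
        Real.sin_lt_sin_of_lt_of_le_pi_div_two (by linarith) (by linarith) (by linarith)
      have e1 : k * (Real.pi / n) + Real.pi / n / 2 = Real.pi / 2 - Real.pi / n := by linarith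
      rw [e1, Real.sin_pi_div_two_sub] at hlt
      have hA : A₁ n r k = 2 * r * Real.cos (3 * (Real.pi / n / 2)) * Real.cos (Real.pi / n / 2) := by
        have e2 : k * (Real.pi / n) + Real.pi / n = Real.pi / 2 - Real.pi / n / 2 := by linarith
        rw [A₁_eq, e2, hangle, Real.sin_pi_div_two_sub, Real.sin_pi_div_two_sub]
      have hcos : 0 < Real.cos (Real.pi / n / 2) :=
        Real.cos_pos_of_mem_Ioo ⟨by linarith, by linarith⟩
      have hcc : 0 ≤ Real.cos (Real.pi / n) :=
        Real.cos_nonneg_of_neg_pi_div_two_le_of_le (by linarith) (by linarith)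
      have hs1 : 0 ≤ Real.sin (Real.pi / n / 2) :=
        Real.sin_nonneg_of_nonneg_of_le_pi (by linarith) (by linarith)
      have hs2 : 0 ≤ Real.sin (Real.pi / n) :=
        Real.sin_nonneg_of_nonneg_of_le_pi (by linarith) (by linarith)
      have hsum : Real.cos (3 * (Real.pi / n / 2)) ≤ Real.cos (Real.pi / n) * Real.cos (Real.pi / n / 2) := by
        have e3 : 3 * (Real.pi / n / 2) = Real.pi / n + Real.pi / n / 2 := by ring
        rw [e3, Real.cos_add]
        have := mul_nonneg hs2 hs1
        linarith
      have k1 : s * Real.cos (Real.pi / n) < A₁ n r k := by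
        rw [← f3]; exact mul_lt_mul_of_pos_left hlt hs
      have k2 : A₁ n r k ≤ lam n r * Real.cos (Real.pi / n) := by
        rw [hA, lam_eq]
        have := mul_le_mul_of_nonneg_left hsum (mul_pos (mul_pos two_pos hr) hcos).le
        linarith
      have k3 := mul_le_mul_of_nonneg_right hlam hcc
      linarith
    refine hle_of _ (by linarith) hmid ?_
    rw [Real.sin_add]
    have hcα : 0 ≤ Real.cos (vertexAngle n r k s) :=
      Real.cos_nonneg_of_neg_pi_div_two_le_of_le (by linarith) (by linarith)
    have hs2 : 0 ≤ Real.sin (Real.pi / n) :=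
      Real.sin_nonneg_of_nonneg_of_le_pi (by linarith) (by linarith)
    have hcα' : Real.cos (vertexAngle n r k s) ≤ Real.cos (k * (Real.pi / n)) :=
      Real.cos_le_cos_of_nonneg_of_le_pi hk0 (by linarith) f4
    rw [ell_eq] at h2
    have e2 : ((k + 1 : ℕ) : ℝ) * (Real.pi / n) = k * (Real.pi / n) + Real.pi / n := by
      push_cast; ring
    have hlam' : lam n r = 2 * r * Real.sin (k * (Real.pi / n) + Real.pi / n) *
        Real.sin (k * (Real.pi / n) + Real.pi / n) := by
      have e3 : k * (Real.pi / n) + Real.pi / n = Real.pi / 2 - Real.pi / n / 2 := by linarith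
      rw [e3, Real.sin_pi_div_two_sub, lam_eq]; ring
    rw [e2] at h2
    have k1 : s * Real.cos (vertexAngle n r k s) ≤
        2 * r * Real.sin (k * (Real.pi / n) + Real.pi / n) * Real.cos (k * (Real.pi / n)) :=
      mul_le_mul h2.le hcα' hcα (hs.le.trans h2.le)
    have k2 := mul_le_mul_of_nonneg_right k1 hs2
    have k3 : s * Real.sin (vertexAngle n r k s) =
        2 * r * Real.sin (k * (Real.pi / n)) * Real.sin (k * (Real.pi / n) + Real.pi / n) := by
      rw [f3, A₁_eq]
    rw [hlam']
    nth_rewrite 2 [Real.sin_add (k * (Real.pi / n))]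
    calc s * (Real.sin (vertexAngle n r k s) * Real.cos (Real.pi / n) +
          Real.cos (vertexAngle n r k s) * Real.sin (Real.pi / n))
        = s * Real.sin (vertexAngle n r k s) * Real.cos (Real.pi / n) +
          s * Real.cos (vertexAngle n r k s) * Real.sin (Real.pi / n) := by ring
      _ ≤ _ := by rw [k3]; linarith
  set ρ := r * Real.cos (Real.pi / n)
  set m := vertexAngle n r k s - k * (Real.pi / n) with hm
  set x := α₂ - (k * (Real.pi / n) + Real.pi / n) with hx
  set D := fun ψ => chordDist ρ ((k + 1 : ℕ) * (Real.pi / n)) s (ψ - Real.pi / n) with hD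
  have hDc : Continuous D := (continuous_chordDist _ _ _).comp (continuous_sub_right _)
  obtain ⟨hE₁, hI₁⟩ := integral_ite (f := fun _ => 0) (g := D) (a := x) (m := Real.pi / n - x)
    (b := Real.pi / n) (by linarith) (by linarith) (by simp) (hDc.intervalIntegrable _ _)
  obtain ⟨hE₂, hI₂⟩ := integral_ite (f := D)
    (a := m) (m := x) (b := Real.pi / n) (by linarith) (by linarith)
    (hDc.intervalIntegrable _ _) hE₁
  obtain ⟨hE, hI⟩ := integral_ite (f := chordDist ρ (k * (Real.pi / n)) s)
    (a := 0) (m := m) (b := Real.pi / n) (by linarith) (by linarith)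
    ((continuous_chordDist _ _ _).intervalIntegrable _ _) hE₂
  have eprim : α₂ - (k * (Real.pi / n) + Real.pi / n + Real.pi / n) = x - Real.pi / n := by
    rw [hx]; ring
  have eneg : Real.pi / n - x - Real.pi / n = -x := by ring
  rw [F_eq_integral hn hr θ hs (k := k) (S := {m, x, Real.pi / n - x})
    ((Set.toFinite _).countable) hE, hI, hI₂, hI₁]
  · simp only [hD]
    rw [integral_chordDist, integral_chordDist_sub, integral_chordDist_sub, sub_self,
      chordDistPrim_zero, chordDistPrim_zero, eneg, chordDistPrim_neg, eprim,
      intervalIntegral.integral_const, smul_zero]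
    ring
  · intro j ψ hψ hψS
    simp only [Set.mem_insert_iff, Set.mem_singleton_iff, not_or] at hψS
    obtain ⟨n1, n2, n3⟩ := hψS
    have hψ1 := hψ.1
    have hψ2 := hψ.2
    have hsmall : ∀ y, 0 ≤ y → y < α₂ → s * Real.sin y < A₁ n r (k + 1) := by
      intro y hy0 hy
      rw [A₁_odd hk, ← hsα₂]
      exact mul_lt_mul_of_pos_left
        (Real.sin_lt_sin_of_lt_of_le_pi_div_two (by linarith) hα₂1 hy) hs
    have hlarge : ∀ y, Real.pi - α₂ < y → y ≤ Real.pi → s * Real.sin y < A₁ n r (k + 1) := by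
      intro y hy hy1
      rw [← Real.sin_pi_sub]
      exact hsmall _ (by linarith) (by linarith)
    by_cases c1 : ψ < m
    · rw [if_pos c1]
      exact regular_small hn hr hk2.le hs h1 h2 θ j hψ1 c1
    rw [if_neg c1]
    have c1' : m < ψ := lt_of_le_of_ne (not_lt.1 c1) (Ne.symm n1)
    by_cases c2 : ψ < x
    · rw [if_pos c2]
      exact regular_large hn hr hk2 hs h1 h2 θ j hψ2 c1' (hsmall _ (by linarith) (by linarith))
        (hlarge _ (by linarith) (by linarith))
    rw [if_neg c2]
    have c2' : x < ψ := lt_of_le_of_ne (not_lt.1 c2) (Ne.symm n2)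
    by_cases c3 : ψ < Real.pi / n - x
    · rw [if_pos c3]
      have hsin := sin_lt_sin_of_mem hα₂0 (x := (k + 2) * (Real.pi / n) - ψ) (by linarith) (by linarith)
      refine regular_short_of_width (by omega) hr θ j ?_ ?_
      · exact Real.sin_nonneg_of_nonneg_of_le_pi (by linarith) (by linarith)
      · rw [← lam_eq_width, ← hsα₂]
        exact mul_lt_mul_of_pos_left hsin hs
    · rw [if_neg c3]
      have c3' : Real.pi / n - x < ψ := lt_of_le_of_ne (not_lt.1 c3) (Ne.symm n3)
      exact regular_large hn hr hk2 hs h1 h2 θ j hψ2 c1' (hsmall _ (by linarith) (by linarith))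
        (hsmall _ (by linarith) (by linarith))

/-! ### The closed form -/

/-- Here (k+2)π/n ≤ π/2, so the sine increases up to it, and A₁(k+1) = ℓ_{k+1} sin((k+2)π/n) exceeds
every s sin x in question. -/
lemma F_eq_of_step_le (hn : 3 ≤ n) (hr : 0 < r) (hk : 2 * (k + 2) ≤ n) (hs : 0 < s)
    (h1 : ell n r k ≤ s) (h2 : s < ell n r (k + 1)) (θ : ℝ) :
    F n r θ s = 1 - h n r k s (A₁ n r k) (B₁ n k)
      + h n r (k + 1) s (A₁ n r k) (B₁ n k + Real.pi / n) := by
  refine F_eq_of_all_long hn hr (by omega) hs h1 h2 θ fun x hx1 hx2 => ?_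
  have hc0 := step_pos (n := n) (by omega)
  have hp := Real.pi_pos
  have hk0 : 0 ≤ k * (Real.pi / n) := by positivity
  have hle := step_mul_le (n := n) (k := k + 2) (by omega) hk
  rw [ell_eq] at h2
  have e : ((k + 1 : ℕ) : ℝ) * (Real.pi / n) + Real.pi / n = (k + 2) * (Real.pi / n) := by
    push_cast; ring
  push_cast at hle
  rw [A₁_eq, e]
  have hsin := Real.sin_lt_sin_of_lt_of_le_pi_div_two (by linarith) hle hx2
  have hsx := Real.sin_nonneg_of_nonneg_of_le_pi (x := x) (by linarith) (by linarith)
  calc s * Real.sin x < s * Real.sin ((k + 2) * (Real.pi / n)) := mul_lt_mul_of_pos_left hsin hs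
    _ ≤ _ := mul_le_mul_of_nonneg_right h2.le (hsx.trans hsin.le)

lemma F_eq_H (hn : 3 ≤ n) (hr : 0 < r) (hk : k ≤ K n) (hs : 0 < s)
    (h1 : ell n r k ≤ s) (h2 : s < ell n r (k + 1)) (θ : ℝ) : F n r θ s = H n r k s := by
  rcases Nat.even_or_odd n with hpar | hpar
  · have hno : ¬ Odd n := Nat.not_odd_iff_even.2 hpar
    have hK : n = 2 * (K n + 1) := by obtain ⟨m, hm⟩ := hpar; unfold K; omega
    rcases hk.lt_or_eq with hlt | rfl
    · rw [H, if_pos (Or.inl ⟨hpar, hlt⟩)]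
      exact F_eq_of_step_le hn hr (by omega) hs h1 h2 θ
    · rw [H, if_neg (by simp [hno]), if_neg (by simp [hno])]
      exact F_eq_even_last hn hr hK.symm hs h1 h2 θ
  · have hne : ¬ Even n := Nat.not_even_iff_odd.2 hpar
    have hK : n = 2 * K n + 3 := by obtain ⟨m, hm⟩ := hpar; unfold K; omega
    by_cases hlam : s < lam n r
    · rw [H, if_pos (Or.inr ⟨hpar, hlam⟩)]
      rcases hk.lt_or_eq with hlt | hkK
      · exact F_eq_of_step_le hn hr (by omega) hs h1 h2 θ
      · refine F_eq_of_all_long hn hr (by omega) hs h1 h2 θ fun x _ _ => ?_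
        rw [A₁_odd (by omega)]
        exact (mul_le_of_le_one_right hs.le (Real.sin_le_one x)).trans_lt hlam
    · rw [H, if_neg (by simp [hne, hlam]), if_pos ⟨hpar, not_lt.1 hlam⟩]
      -- For k < K, s < ℓ_{k+1} ≤ ℓ_K ≤ λ would contradict λ ≤ s.
      have hkK : k = K n := by
        by_contra hne'
        have hlt : k + 1 ≤ K n := by omega
        have hle : ell n r (k + 1) ≤ ell n r (K n) := by
          rw [ell_eq, ell_eq]
          have hc0 := step_pos (n := n) (by omega)
          have hp := Real.pi_pos
          refine mul_le_mul_of_nonneg_left ?_ (by positivity)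
          refine Real.sin_le_sin_of_le_of_le_pi_div_two ?_ (step_mul_le (by omega) (by omega)) ?_
          · have : 0 ≤ ((k + 1 : ℕ) : ℝ) * (Real.pi / n) := by positivity
            linarith
          · exact mul_le_mul_of_nonneg_right (by exact_mod_cast hlt) hc0.le
        have := ell_le_lam hK hr
        linarith [not_lt.1 hlam]
      subst hkK
      exact F_eq_odd_last hn hr hK hs h1 h2 (not_lt.1 hlam) θ

lemma tendsto_H_zero (hn : 3 ≤ n) (hr : 0 < r) :
    Filter.Tendsto (H n r 0) (nhdsWithin 0 (Set.Ioi 0)) (nhds 0) := by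
  have hc0 := step_pos (n := n) (by omega)
  have hp := Real.pi_pos
  have hc : Real.pi / n < Real.pi / 2 := by
    have := step_mul_lt (n := n) (k := 1) (by omega) (by omega)
    simpa using this
  have hsin := (Real.sin_pos_of_pos_of_lt_pi hc0 (by linarith)).ne'
  have hcos : 0 < Real.cos (Real.pi / n) := Real.cos_pos_of_mem_Ioo ⟨by linarith, by linarith⟩
  have hlam : 0 < lam n r := by rw [lam_eq_width]; positivity
  have hev : ∀ᶠ s in nhdsWithin (0 : ℝ) (Set.Ioi 0),
      -- With k = 0 both A₁ and B₁ vanish, so the 1/s and arcsin terms drop out, and Θ₃ = -1 cancels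
      -- the leading 1; `H` is linear near 0.
      Θ₁ n r 1 0 (Real.pi / n) * s = H n r 0 s := by
    filter_upwards [Ioo_mem_nhdsGT hlam] with s hs
    have hs0 : s ≠ 0 := hs.1.ne'
    have hcond : (Even n ∧ 0 < K n) ∨ (Odd n ∧ s < lam n r) := by
      rcases Nat.even_or_odd n with hpar | hpar
      · exact Or.inl ⟨hpar, by obtain ⟨m, hm⟩ := hpar; unfold K; omega⟩
      · exact Or.inr ⟨hpar, hs.2⟩
    have hA : A₁ n r 0 = 0 := by simp [A₁]
    have hB : B₁ n 0 = 0 := by simp [B₁]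
    rw [H, if_pos hcond, hA, hB]
    simp only [h, if_true, zero_add, if_neg one_ne_zero, L₁, L₂, L₃, L₄, Θ₂, Θ₃]
    simp only [csc, sec, cot, zero_div, Real.arcsin_zero, Nat.cast_one, one_mul, zero_mul,
      mul_zero, add_zero, sub_zero]
    have hsq : Real.sqrt (s ^ 2 - 0 ^ 2) = s := by simp [Real.sqrt_sq hs.1.le]
    rw [hsq]
    field_simp
    ring
  refine Filter.Tendsto.congr' hev ?_
  have hcont : Continuous fun s : ℝ => Θ₁ n r 1 0 (Real.pi / n) * s := by fun_prop
  have := hcont.tendsto 0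
  rw [mul_zero] at this
  exact this.mono_left nhdsWithin_le_nhds

/-- The closed form contains 1/s, so s = 0 is reached by monotonicity: 0 ≤ F(0) ≤ F(s) = H_0(s),
which tends to 0. -/
lemma F_zero (hn : 3 ≤ n) (hr : 0 < r) (θ : ℝ) : F n r θ 0 = 0 := by
  refine le_antisymm (ge_of_tendsto (tendsto_H_zero hn hr) ?_) (F_nonneg hn hr θ 0)
  have hc0 := step_pos (n := n) (by omega)
  have hell : 0 < ell n r (0 + 1) := by
    rw [ell_eq]
    have := Real.sin_pos_of_pos_of_lt_pi hc0
      (div_lt_self Real.pi_pos (by exact_mod_cast (by omega : 1 < n)))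
    simpa using by positivity
  filter_upwards [Ioo_mem_nhdsGT hell] with s hs
  rw [← F_eq_H hn hr (Nat.zero_le _) hs.1 (by simpa [ell] using hs.1.le) hs.2 θ]
  exact F_mono_of_nonneg hn hr θ le_rfl hs.1.le

end

end ChordLength

end

theorem theorem1 (n : ℕ) (hn : 3 ≤ n) (r : ℝ) (hr : 0 < r) (θ : ℝ) :
    (∀ s : ℝ, s < 0 → ChordLength.F n r θ s = 0) ∧
    (ChordLength.F n r θ 0 = 0 ∧
      Filter.Tendsto (ChordLength.H n r 0) (nhdsWithin 0 (Set.Ioi 0))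
        (nhds (ChordLength.F n r θ 0))) ∧
    (∀ k : ℕ, k ≤ ChordLength.K n → ∀ s : ℝ, s ≠ 0 →
      ChordLength.ell n r k ≤ s → s < ChordLength.ell n r (k + 1) →
        ChordLength.F n r θ s = ChordLength.H n r k s) ∧
    (∀ s : ℝ, ChordLength.ell n r (ChordLength.K n + 1) ≤ s → ChordLength.F n r θ s = 1) := by
  refine ⟨fun s hs => ChordLength.F_of_neg r θ hs, ⟨ChordLength.F_zero hn hr θ, ?_⟩, ?_,
    fun s hs => ChordLength.F_of_ell_le hn hr θ hs⟩
  · rw [ChordLength.F_zero hn hr θ]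
    exact ChordLength.tendsto_H_zero hn hr
  · intro k hk s hs0 h1 h2
    have hell : 0 ≤ ChordLength.ell n r k := by
      rw [ChordLength.ell_eq]
      have hk2 : 2 * k ≤ n := by unfold ChordLength.K at hk; omega
      have hle := ChordLength.step_mul_le (n := n) (k := k) (by omega) hk2
      have := Real.sin_nonneg_of_nonneg_of_le_pi (x := k * (Real.pi / n)) (by positivity)
        (by linarith [Real.pi_pos])
      positivity
    exact ChordLength.F_eq_H hn hr hk (lt_of_le_of_ne (hell.trans h1) (Ne.symm hs0)) h1 h2 θ
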